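/- Let $(\Omega,\mathcal F,(\mathcal F_t),P)$ be a filtered probability space carrying a $d$-dimensional $(\mathcal F_t)$-Brownian motion $W$ on $[0,T]$, let $T,\varepsilon>0$, and let $X$ be a strong solution of $dX_t=b(X_t,t)\,dt+\sqrt{\varepsilon}\,\sigma(X_t,t)\,dW_t$, $X_0=x_0\in\mathbb R^d$, where $b:\mathbb R^d\times[0,T]\to\mathbb R^d$ and $\sigma:\mathbb R^d\times[0,T]\to\mathbb R^{d\times d}$ are Borel, with $|b(x,t)|+|\sigma(x,t)|\le C(1+|x|)$ and $|b(x,t)-b(y,t)|+|\sigma(x,t)-\sigma(y,t)|\le D|x-y|$. Let $g:\mathbb R^d\to\mathbb R$ be bounded and continuous, $\rho=E_P[e^{-g(X_T)/\varepsilon}]$, $L_T^*=e^{-g(X_T)/\varepsilon}/\rho$, $dQ^*=L_T^*\,dP$. Let $\mathcal U$ be the set of progressively measurable $\mathbb R^d$-valued processes $u$ on $[0,T]$ with $E_P\int_0^T|u_s|^2ds<\infty$; for $u\in\mathcal U$ let $$L_T^u=\exp\Big(-\tfrac1{\sqrt\varepsilon}\int_0^Tu_s\cdot dW_s-\tfrac1{2\varepsilon}\int_0^T|u_s|^2ds\Big),\qquad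 dQ^u=L_T^u\,dP .$$ Write $D_{KL}[Q^*\|Q^u]=\int\log\frac{dQ^*}{dQ^u}\,dQ^*$ (the usual Kullback–Leibler divergence whenever $Q^u$ is a probability measure). 1. For every $u\in\mathcal U$ all the following integrals converge absolutely, $Q^*\ll Q^u$, and $$D_{KL}[Q^*\|Q^u]=E_P[L_T^*\log L_T^*]-E_P[L_T^*\log L_T^u].$$ Hence, for $\mathcal V=\mathcal U$ and more generally for every class $\mathcal V\subseteq\mathcal U$ and every $u\in\mathcal V$: $u$ minimizes $D_{KL}[Q^*\|Q^v]$ over $v\in\mathcal V$ if and only if $u$ maximizes $E_P[L_T^*\log L_T^v]$ over $v\in\mathcal V$. 2. If $W_\theta=\sum_{j=1}^m\theta_j\varphi_j$ with $\varphi_j:\mathbb R^d\times[0,T]\to\mathbb R$ differentiable in $x$, then $-\sigma^\top\nabla_xW_\theta=\sum_{j}\theta_j\psi_j$ with $\psi_j=-\sigma^\top\nabla_x\varphi_j$. From now on let $\sigma=I$. 3. For every $u\in\mathcal U$, $P$-almost surely, $$\log L_T^u=-\frac1\varepsilon\int_0^Tu_t\cdot dX_t+\frac1\varepsilon\int_0^Tu_t\cdot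 b(X_t,t)\,dt-\frac1{2\varepsilon}\int_0^T|u_t|^2dt .$$ Let further $\psi_1,\dots,\psi_m:\mathbb R^d\times[0,T]\to\mathbb R^d$ be Borel with $E_P\int_0^T|\psi_j(X_t,t)|^2dt<\infty$. For $\theta\in\mathbb R^m$ let $u_\theta=\sum_j\theta_j\psi_j$; then the control $u_\theta(X_t,t)$ belongs to $\mathcal U$. Let $L_T^\theta$ and $Q^\theta$ be the corresponding density and measure. 4. For all $\theta^{(k)},\theta\in\mathbb R^m$, with absolutely convergent integrals, $$\int\frac{L_T^*}{L_T^{\theta^{(k)}}}\log L_T^\theta\,dQ^{\theta^{(k)}}=E_P[L_T^*\log L_T^\theta].$$ Consequently, for every $\Theta\subseteq\mathbb R^m$, a point of $\Theta$ minimizes $D_{KL}[Q^*\|Q^\theta]$ over $\theta\in\Theta$ if and only if it maximizes the left-hand side over $\theta\in\Theta$. 5. For every $\theta$, $P$-almost surely, $$\log L_T^\theta=-\frac1\varepsilon\sum_j\theta_j\Big(\int_0^T\psi_j(X_t,t)\cdot dX_t-\int_0^T\psi_j(X_t,t)\cdot b(X_t,t)\,dt\Big)-\frac1{2\varepsilon}\sum_{j,\ell}\theta_j\theta_\ell\int_0^T\psi_j(X_t,t)\cdot\psi_\ell(X_t,t)\,dt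 .$$ The random field $\theta\mapsto\log L_T^\theta$ has a version that is continuous in $\theta$, and for every such version, almost surely, the formula holds simultaneously for all $\theta$ and the field is a concave function of $\theta$. This version is used in 6. 6. Let $\omega_1,\dots,\omega_N$ be i.i.d. samples from $Q^{\theta^{(k)}}$, with sample paths $X^{(i)}_t=X_t(\omega_i)$, let $w_i=L_T^*(\omega_i)/L_T^{\theta^{(k)}}(\omega_i)$ and $\tilde w_i=w_i/\sum_nw_n$, and let $$A^{(k)}_{j\ell}=\sum_{i}\tilde w_i\int_0^T\psi_j(X^{(i)}_t,t)\cdot\psi_\ell(X^{(i)}_t,t)\,dt,$$ $$r^{(k)}_j=\sum_{i}\tilde w_i\Big(\int_0^T\psi_j(X^{(i)}_t,t)\cdot b(X^{(i)}_t,t)\,dt-\int_0^T\psi_j(X^{(i)}_t,t)\cdot dX^{(i)}_t\Big).$$ Then almost surely the following holds for all $\theta\in\mathbb R^m$: $\theta$ maximizes the weighted log-likelihood $\theta'\mapsto\sum_i\tilde w_i\log L_T^{\theta'}(\omega_i)$ over $\mathbb R^m$ if and only if $A^{(k)}\theta=r^{(k)}$. The same equivalence holds for maximization over any $\Theta\subseteq\mathbb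 R^m$ that has $\theta$ in its interior. -/

import Mathlib

open MeasureTheory ProbabilityTheory InformationTheory Set Filter Topology
open scoped BoundedContinuousFunction ENNReal

noncomputable section

namespace CrossEntropy

/-- `ℝ^d` with the Euclidean norm. -/
abbrev E (d : ℕ) := EuclideanSpace ℝ (Fin d)

/-- A `d`-dimensional Brownian motion on `[0, T]` with respect to the filtration `𝓕`. Only the
times in `[0, T]` matter. -/
structure IsBrownianMotion {Ω : Type*} {mΩ : MeasurableSpace Ω} {d : ℕ} (P : Measure Ω)
    (𝓕 : Filtration ℝ mΩ) (T : ℝ) (W : ℝ → Ω → E d) : Prop where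
  adapted : ∀ t ∈ Icc 0 T, StronglyMeasurable[𝓕 t] (W t)
  zero : ∀ᵐ ω ∂P, W 0 ω = 0
  continuous : ∀ᵐ ω ∂P, ContinuousOn (fun t => W t ω) (Icc 0 T)
  indep : ∀ s t, 0 ≤ s → s ≤ t → t ≤ T →
    Indep (𝓕 s) (MeasurableSpace.comap (fun ω => W t ω - W s ω) inferInstance) P
  gaussian : ∀ s t, 0 ≤ s → s ≤ t → t ≤ T →
    P.map (fun ω (i : Fin d) => W t ω i - W s ω i)
      = Measure.pi (fun _ => gaussianReal 0 (t - s).toNNReal)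

/-- Progressive measurability on `[0, T]`: for every `t ∈ [0, T]` the map `(s, ω) ↦ u s ω` on
`[0, t] × Ω` is measurable for the product of the Borel σ-algebra and `𝓕 t`. -/
def ProgressiveOn {Ω : Type*} {mΩ : MeasurableSpace Ω} {d : ℕ}
    (𝓕 : Filtration ℝ mΩ) (T : ℝ) (u : ℝ → Ω → E d) : Prop :=
  ∀ t ∈ Icc 0 T, StronglyMeasurable[MeasurableSpace.prod inferInstance (𝓕 t)]
    (fun p : Icc (0 : ℝ) t × Ω => u p.1 p.2)

/-- `E ∫_0^T |u_s|^2 ds < ∞`. -/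
def SqIntegrable {Ω : Type*} {mΩ : MeasurableSpace Ω} {d : ℕ}
    (P : Measure Ω) (T : ℝ) (u : ℝ → Ω → E d) : Prop :=
  ∫⁻ ω, (∫⁻ s in Icc 0 T, ‖u s ω‖ₑ ^ 2) ∂P < ∞

/-- The control space: progressively measurable processes `u` with `E ∫_0^T |u_s|^2 ds < ∞`. -/
def controls {Ω : Type*} {mΩ : MeasurableSpace Ω} (d : ℕ)
    (P : Measure Ω) (𝓕 : Filtration ℝ mΩ) (T : ℝ) : Set (ℝ → Ω → E d) :=
  {u | ProgressiveOn 𝓕 T u ∧ SqIntegrable P T u}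

/-- Data of a simple adapted process `∑_{i < n} ξ_i 1_{(τ_i, τ_{i+1}]}` on `[0, T]`, with `ξ_i`
bounded and `𝓕 (τ_i)`-measurable. -/
structure SimpleProcess {Ω : Type*} {mΩ : MeasurableSpace Ω}
    (𝓕 : Filtration ℝ mΩ) (T : ℝ) (d : ℕ) where
  n : ℕ
  τ : ℕ → ℝ
  ξ : ℕ → Ω → E d
  monotone : Monotone τ
  mem : ∀ i, τ i ∈ Icc 0 T
  measurable : ∀ i, StronglyMeasurable[𝓕 (τ i)] (ξ i)
  bounded : ∀ i, ∃ K : ℝ, ∀ ω, ‖ξ i ω‖ ≤ K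

/-- The value at time `t` of a simple process. -/
def SimpleProcess.value {Ω : Type*} {mΩ : MeasurableSpace Ω} {𝓕 : Filtration ℝ mΩ} {T : ℝ} {d : ℕ}
    (S : SimpleProcess 𝓕 T d) (t : ℝ) (ω : Ω) : E d :=
  ∑ i ∈ Finset.range S.n, (Ioc (S.τ i) (S.τ (i + 1))).indicator (fun _ => S.ξ i ω) t

/-- The elementary integral `∑_i ξ_i · (Z_{τ_{i+1}} - Z_{τ_i})` of a simple process. -/
def SimpleProcess.integral {Ω : Type*} {mΩ : MeasurableSpace Ω} {𝓕 : Filtration ℝ mΩ} {T : ℝ}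
    {d : ℕ} (S : SimpleProcess 𝓕 T d) (Z : ℝ → Ω → E d) (ω : Ω) : ℝ :=
  ∑ i ∈ Finset.range S.n, inner ℝ (S.ξ i ω) (Z (S.τ (i + 1)) ω - Z (S.τ i) ω)

/-- `Y` is a version of the stochastic integral `∫_0^T H · dZ`: there are simple processes
`S_k → H` in `L²(dt ⊗ P)` whose elementary integrals against `Z` converge to `Y` in probability.
For `Z` a Brownian motion this is the Itô integral; for an Itô process `Z` with
`dZ = β dt + c dW` (`c` constant, `∫ |β|² dt < ∞` a.s.) it is the integral
`∫ H · β dt + c ∫ H · dW`. -/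
def IsStochIntegral {Ω : Type*} {mΩ : MeasurableSpace Ω} {d : ℕ} (P : Measure Ω)
    (𝓕 : Filtration ℝ mΩ) (T : ℝ) (Z H : ℝ → Ω → E d) (Y : Ω → ℝ) : Prop :=
  StronglyMeasurable Y ∧ ∃ S : ℕ → SimpleProcess 𝓕 T d,
    Tendsto (fun k => ∫⁻ ω, (∫⁻ t in Icc 0 T, ‖(S k).value t ω - H t ω‖ₑ ^ 2) ∂P) atTop (𝓝 0) ∧
    TendstoInMeasure P (fun k => (S k).integral Z) atTop Y

open Classical in
/-- The stochastic integral `∫_0^T H · dZ`, as a random variable defined up to null sets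
(a version of it is chosen). -/
def stochIntegral {Ω : Type*} {mΩ : MeasurableSpace Ω} {d : ℕ} (P : Measure Ω)
    (𝓕 : Filtration ℝ mΩ) (T : ℝ) (Z H : ℝ → Ω → E d) : Ω → ℝ :=
  if h : ∃ Y, IsStochIntegral P 𝓕 T Z H Y then h.choose else 0

/-- The Frobenius norm of a matrix. -/
def frob {d : ℕ} (A : Matrix (Fin d) (Fin d) ℝ) : ℝ := Real.sqrt (∑ i, ∑ j, A i j ^ 2)

/-- The `i`-th row of `σ(X_s, s)`, as a process. -/
def rowProcess {Ω : Type*} {d : ℕ} (σ : E d → ℝ → Matrix (Fin d) (Fin d) ℝ) (X : ℝ → Ω → E d)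
    (i : Fin d) : ℝ → Ω → E d :=
  fun s ω => WithLp.toLp 2 (fun j => σ (X s ω) s i j)

/-- `X` is a strong solution on `[0, T]` of
`dX = b(X, s) ds + √ε σ(X, s) dW`, `X_0 = x₀`. -/
structure IsStrongSolution {Ω : Type*} {mΩ : MeasurableSpace Ω} {d : ℕ} (P : Measure Ω)
    (𝓕 : Filtration ℝ mΩ) (T ε : ℝ) (W : ℝ → Ω → E d) (b : E d → ℝ → E d)
    (σ : E d → ℝ → Matrix (Fin d) (Fin d) ℝ) (x₀ : E d) (X : ℝ → Ω → E d) : Prop where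
  adapted : ∀ t ∈ Icc 0 T, StronglyMeasurable[𝓕 t] (X t)
  continuous : ∀ ω, ContinuousOn (fun t => X t ω) (Icc 0 T)
  sqIntegrable : ∀ i, SqIntegrable P T (rowProcess σ X i)
  eq : ∀ t ∈ Icc 0 T, ∀ᵐ ω ∂P,
    X t ω = x₀ + (∫ s in (0 : ℝ)..t, b (X s ω) s)
      + Real.sqrt ε • WithLp.toLp 2 (fun i => stochIntegral P 𝓕 t W (rowProcess σ X i) ω)

/-- `ρ = E_P[exp(-g(X_T)/ε)]`. -/
def rho {Ω : Type*} {mΩ : MeasurableSpace Ω} {d : ℕ} (P : Measure Ω) (T ε : ℝ)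
    (X : ℝ → Ω → E d) (g : E d →ᵇ ℝ) : ℝ :=
  ∫ ω, Real.exp (-g (X T ω) / ε) ∂P

/-- The zero-variance density `L*_T = exp(-g(X_T)/ε) / ρ`. -/
def optDensity {Ω : Type*} {mΩ : MeasurableSpace Ω} {d : ℕ} (P : Measure Ω) (T ε : ℝ)
    (X : ℝ → Ω → E d) (g : E d →ᵇ ℝ) (ω : Ω) : ℝ :=
  Real.exp (-g (X T ω) / ε) / rho P T ε X g

/-- The Girsanov density `L^u_T = exp(-(1/√ε) ∫_0^T u · dW - (1/(2ε)) ∫_0^T |u|² ds)`. -/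
def girsanovDensity {Ω : Type*} {mΩ : MeasurableSpace Ω} {d : ℕ} (P : Measure Ω)
    (𝓕 : Filtration ℝ mΩ) (T ε : ℝ) (W : ℝ → Ω → E d) (u : ℝ → Ω → E d) (ω : Ω) : ℝ :=
  Real.exp (-(1 / Real.sqrt ε) * stochIntegral P 𝓕 T W u ω
    - 1 / (2 * ε) * ∫ s in (0 : ℝ)..T, ‖u s ω‖ ^ 2)

/-- The measure `Q*` with `dQ*/dP = L*_T`. -/
def optMeasure {Ω : Type*} {mΩ : MeasurableSpace Ω} {d : ℕ} (P : Measure Ω) (T ε : ℝ)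
    (X : ℝ → Ω → E d) (g : E d →ᵇ ℝ) : Measure Ω :=
  P.withDensity (fun ω => ENNReal.ofReal (optDensity P T ε X g ω))

/-- The measure `Q^u` with `dQ^u/dP = L^u_T`. -/
def controlMeasure {Ω : Type*} {mΩ : MeasurableSpace Ω} {d : ℕ} (P : Measure Ω)
    (𝓕 : Filtration ℝ mΩ) (T ε : ℝ) (W : ℝ → Ω → E d) (u : ℝ → Ω → E d) : Measure Ω :=
  P.withDensity (fun ω => ENNReal.ofReal (girsanovDensity P 𝓕 T ε W u ω))

/-- `∫ log (dμ/dν) dμ`. -/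
def klIntegral {Ω : Type*} {mΩ : MeasurableSpace Ω} (μ ν : Measure Ω) : ℝ := ∫ ω, llr μ ν ω ∂μ

/-- The cross-entropy objective `E_P[L*_T log L^u_T]`. -/
def ceObjective {Ω : Type*} {mΩ : MeasurableSpace Ω} {d : ℕ} (P : Measure Ω)
    (𝓕 : Filtration ℝ mΩ) (T ε : ℝ) (W X : ℝ → Ω → E d) (g : E d →ᵇ ℝ) (u : ℝ → Ω → E d) : ℝ :=
  ∫ ω, optDensity P T ε X g ω * Real.log (girsanovDensity P 𝓕 T ε W u ω) ∂P

/-- The Markov control `u_θ(X_t, t) = ∑_j θ_j ψ_j(X_t, t)` as a process. -/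
def linControl {Ω : Type*} {d m : ℕ} (X : ℝ → Ω → E d) (ψ : Fin m → E d → ℝ → E d)
    (θ : Fin m → ℝ) : ℝ → Ω → E d :=
  fun t ω => ∑ j, θ j • ψ j (X t ω) t

/-- `∫_0^T ψ_j(X_t, t) · ψ_l(X_t, t) dt` along the path of `ω`. -/
def gram {Ω : Type*} {d m : ℕ} (T : ℝ) (X : ℝ → Ω → E d) (ψ : Fin m → E d → ℝ → E d)
    (j l : Fin m) (ω : Ω) : ℝ :=
  ∫ t in (0 : ℝ)..T, inner ℝ (ψ j (X t ω) t) (ψ l (X t ω) t)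

/-- `∫_0^T ψ_j(X_t, t) · b(X_t, t) dt` along the path of `ω`. -/
def driftIntegral {Ω : Type*} {d m : ℕ} (T : ℝ) (b : E d → ℝ → E d) (X : ℝ → Ω → E d)
    (ψ : Fin m → E d → ℝ → E d) (j : Fin m) (ω : Ω) : ℝ :=
  ∫ t in (0 : ℝ)..T, inner ℝ (ψ j (X t ω) t) (b (X t ω) t)

/-- `∫_0^T ψ_j(X_t, t) · dX_t` along the path of `ω`. -/
def pathIntegral {Ω : Type*} {mΩ : MeasurableSpace Ω} {d m : ℕ} (P : Measure Ω)
    (𝓕 : Filtration ℝ mΩ) (T : ℝ) (X : ℝ → Ω → E d) (ψ : Fin m → E d → ℝ → E d)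
    (j : Fin m) (ω : Ω) : ℝ :=
  stochIntegral P 𝓕 T X (fun t ω => ψ j (X t ω) t) ω

/-- The quadratic function of `θ`
`-(1/ε) ∑_j θ_j (∫ ψ_j·dX - ∫ ψ_j·b dt) - (1/(2ε)) ∑_{j,l} θ_j θ_l ∫ ψ_j·ψ_l dt`. -/
def quadForm {Ω : Type*} {mΩ : MeasurableSpace Ω} {d m : ℕ} (P : Measure Ω)
    (𝓕 : Filtration ℝ mΩ) (T ε : ℝ) (b : E d → ℝ → E d) (X : ℝ → Ω → E d)
    (ψ : Fin m → E d → ℝ → E d) (θ : Fin m → ℝ) (ω : Ω) : ℝ :=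
  -(1 / ε) * ∑ j, θ j * (pathIntegral P 𝓕 T X ψ j ω - driftIntegral T b X ψ j ω)
    - 1 / (2 * ε) * ∑ j, ∑ l, θ j * θ l * gram T X ψ j l ω

/-- `ℓ` is a version of the random field `θ ↦ log L^θ_T` with continuous sample functions: each
`log L^θ_T` is only defined up to a `P`-null set that may depend on `θ`. -/
def IsLogLikelihood {Ω : Type*} {mΩ : MeasurableSpace Ω} {d m : ℕ} (P : Measure Ω)
    (𝓕 : Filtration ℝ mΩ) (T ε : ℝ) (W X : ℝ → Ω → E d) (ψ : Fin m → E d → ℝ → E d)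
    (ℓ : (Fin m → ℝ) → Ω → ℝ) : Prop :=
  (∀ θ, ∀ᵐ ω ∂P, ℓ θ ω = Real.log (girsanovDensity P 𝓕 T ε W (linControl X ψ θ) ω)) ∧
    ∀ᵐ ω ∂P, Continuous (fun θ => ℓ θ ω)

/-- The weight `w(ω) = L*_T(ω) / L^{θ_k}_T(ω)`. -/
def weight {Ω : Type*} {mΩ : MeasurableSpace Ω} {d m : ℕ} (P : Measure Ω)
    (𝓕 : Filtration ℝ mΩ) (T ε : ℝ) (W X : ℝ → Ω → E d) (g : E d →ᵇ ℝ)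
    (ψ : Fin m → E d → ℝ → E d) (θk : Fin m → ℝ) (ω : Ω) : ℝ :=
  optDensity P T ε X g ω / girsanovDensity P 𝓕 T ε W (linControl X ψ θk) ω

/-- The self-normalized weights of the sample paths `x 0, …, x (N-1)`. -/
def normWeight {Ω : Type*} {mΩ : MeasurableSpace Ω} {d m N : ℕ} (P : Measure Ω)
    (𝓕 : Filtration ℝ mΩ) (T ε : ℝ) (W X : ℝ → Ω → E d) (g : E d →ᵇ ℝ)
    (ψ : Fin m → E d → ℝ → E d) (θk : Fin m → ℝ) (x : Fin N → Ω) (i : Fin N) : ℝ :=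
  weight P 𝓕 T ε W X g ψ θk (x i) / ∑ n, weight P 𝓕 T ε W X g ψ θk (x n)

/-- The matrix `A_{jl} = ∑_i w̃_i ∫ ψ_j·ψ_l dt` of the weighted normal equations. -/
def normalMatrix {Ω : Type*} {d m N : ℕ} (T : ℝ) (X : ℝ → Ω → E d)
    (ψ : Fin m → E d → ℝ → E d) (w : Fin N → ℝ) (x : Fin N → Ω) : Matrix (Fin m) (Fin m) ℝ :=
  Matrix.of fun j l => ∑ i, w i * gram T X ψ j l (x i)

/-- The right-hand side `r_j = ∑_i w̃_i (∫ ψ_j·b dt - ∫ ψ_j·dX)`. -/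
def normalVector {Ω : Type*} {mΩ : MeasurableSpace Ω} {d m N : ℕ} (P : Measure Ω)
    (𝓕 : Filtration ℝ mΩ) (T : ℝ) (b : E d → ℝ → E d) (X : ℝ → Ω → E d)
    (ψ : Fin m → E d → ℝ → E d) (w : Fin N → ℝ) (x : Fin N → Ω) : Fin m → ℝ :=
  fun j => ∑ i, w i * (driftIntegral T b X ψ j (x i) - pathIntegral P 𝓕 T X ψ j (x i))

end CrossEntropy

end

open CrossEntropy

/-! Both `Q*` and `Q^u` have strictly positive densities with respect to `P`, so `log (dQ*/dQ^u) =
log L* - log L^u` almost surely. Since `g` is bounded, so is `L*`; and `log L^u` is `P`-integrable,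
being a combination of an Itô integral in `L²` and the integrable energy. Hence the divergence is a
constant minus the cross-entropy objective, whether or not `Q^u` has mass one, and Girsanov's
theorem never enters (`klIntegral_controlMeasure`). Sampling from another control only inserts a
positive factor that cancels (`integral_weight_mul`).

The analytic work lies in the stochastic integral, which is defined by choosing a limit of
elementary integrals. That a limit exists is the density of simple processes among the controls
(`exists_simpleProcess_tendsto`): truncate, average over the preceding cell of a partition, and
apply Lebesgue differentiation. That it is unique is the Itô isometry, proved on the span of the
elementary integrands and passed to the `L²`-closure of its graph; as the closure is a submodule,
linearity comes for free (`ae_eq_of_mem_itoGraph`).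

For `σ = 1` an elementary integral against `X` splits path by path into a drift integral and `√ε`
times the elementary integral against `W`. The drift is bounded along each continuous path, so both
parts converge along a subsequence, which gives `stochIntegral_solution` and the formula in terms of
`dX`.

By linearity `log L^θ` is, for fixed `θ`, a quadratic function whose matrix is the Gram matrix of
the path, positive semidefinite because its form is an energy. A continuous version satisfies the
formula for all `θ` at once, through a countable dense set. The sampling law is absolutely
continuous with respect to `P`, so the formula holds at every sample; nonnegative weights preserve
concavity, and an interior point is a maximum exactly when the gradient vanishes
(`isMaxOn_quadFun_iff`). -/

namespace CrossEntropy

/-! ### Moments and covariances of Brownian increments -/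

section Increments

variable {Ω : Type*} {mΩ : MeasurableSpace Ω} {P : Measure Ω} {𝓕 : Filtration ℝ mΩ} {d : ℕ}
  {T : ℝ} {W : ℝ → Ω → E d}

lemma IsBrownianMotion.mono (hW : IsBrownianMotion P 𝓕 T W) {t : ℝ} (ht : t ≤ T) :
    IsBrownianMotion P 𝓕 t W where
  adapted s hs := hW.adapted s ⟨hs.1, hs.2.trans ht⟩
  zero := hW.zero
  continuous := hW.continuous.mono fun _ h => h.mono (Icc_subset_Icc_right ht)
  indep r s h0 h1 h2 := hW.indep r s h0 h1 (h2.trans ht)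
  gaussian r s h0 h1 h2 := hW.gaussian r s h0 h1 (h2.trans ht)

lemma IsBrownianMotion.stronglyMeasurable (hW : IsBrownianMotion P 𝓕 T W) {t : ℝ}
    (ht : t ∈ Icc 0 T) : StronglyMeasurable (W t) :=
  (hW.adapted t ht).mono (𝓕.le t)

lemma IsBrownianMotion.measurable_increment (hW : IsBrownianMotion P 𝓕 T W) {s t : ℝ}
    (hs : 0 ≤ s) (hst : s ≤ t) (ht : t ≤ T) (i : Fin d) :
    Measurable (fun ω => W t ω i - W s ω i) := by
  have h1 := (hW.stronglyMeasurable ⟨hs.trans hst, ht⟩).measurable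
  have h2 := (hW.stronglyMeasurable ⟨hs, hst.trans ht⟩).measurable
  fun_prop

lemma IsBrownianMotion.map_increment_apply (hW : IsBrownianMotion P 𝓕 T W) {s t : ℝ}
    (hs : 0 ≤ s) (hst : s ≤ t) (ht : t ≤ T) (i : Fin d) :
    P.map (fun ω => W t ω i - W s ω i) = gaussianReal 0 (t - s).toNNReal := by
  have h : (fun ω => W t ω i - W s ω i)
      = Function.eval i ∘ (fun ω (i : Fin d) => W t ω i - W s ω i) := rfl
  rw [h, ← Measure.map_map (measurable_pi_apply i)
    (measurable_pi_lambda _ fun j => hW.measurable_increment hs hst ht j),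
    hW.gaussian s t hs hst ht]
  exact (measurePreserving_eval (fun _ : Fin d => gaussianReal 0 (t - s).toNNReal) i).map_eq

lemma IsBrownianMotion.memLp_increment (hW : IsBrownianMotion P 𝓕 T W) {s t : ℝ}
    (hs : 0 ≤ s) (hst : s ≤ t) (ht : t ≤ T) (i : Fin d) :
    MemLp (fun ω => W t ω i - W s ω i) 2 P := by
  have h : MemLp id 2 (P.map (fun ω => W t ω i - W s ω i)) := by
    rw [hW.map_increment_apply hs hst ht i]
    exact memLp_id_gaussianReal 2
  exact (memLp_map_measure_iff h.1 (hW.measurable_increment hs hst ht i).aemeasurable).1 h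

lemma IsBrownianMotion.integral_increment (hW : IsBrownianMotion P 𝓕 T W) {s t : ℝ}
    (hs : 0 ≤ s) (hst : s ≤ t) (ht : t ≤ T) (i : Fin d) :
    ∫ ω, (W t ω i - W s ω i) ∂P = 0 := by
  rw [← integral_map (φ := fun ω => W t ω i - W s ω i) (f := fun x => x)
    (hW.measurable_increment hs hst ht i).aemeasurable (by fun_prop),
    hW.map_increment_apply hs hst ht i, integral_id_gaussianReal]

lemma IsBrownianMotion.integral_increment_mul (hW : IsBrownianMotion P 𝓕 T W) {s t : ℝ}
    (hs : 0 ≤ s) (hst : s ≤ t) (ht : t ≤ T) (i j : Fin d) :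
    ∫ ω, (W t ω i - W s ω i) * (W t ω j - W s ω j) ∂P = if i = j then t - s else 0 := by
  split_ifs with hij
  · subst hij
    rw [← integral_map (φ := fun ω => W t ω i - W s ω i) (f := fun x => x * x)
      (hW.measurable_increment hs hst ht i).aemeasurable (by fun_prop),
      hW.map_increment_apply hs hst ht i]
    have h := variance_fun_id_gaussianReal (μ := 0) (v := (t - s).toNNReal)
    rw [variance_of_integral_eq_zero (by fun_prop) integral_id_gaussianReal] at h
    simp only [pow_two] at h
    rw [h, Real.coe_toNNReal _ (by linarith)]
  · have hm : Measurable (fun ω (i : Fin d) => W t ω i - W s ω i) :=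
      measurable_pi_lambda _ fun j => hW.measurable_increment hs hst ht j
    rw [← integral_map (φ := fun ω (i : Fin d) => W t ω i - W s ω i) (f := fun x => x i * x j)
      hm.aemeasurable (by fun_prop), hW.gaussian s t hs hst ht]
    have hind := iIndepFun_pi (μ := fun _ : Fin d => gaussianReal 0 (t - s).toNNReal)
      (X := fun _ x => x) (fun _ => by fun_prop)
    have h2 := (hind.indepFun hij).integral_fun_mul_eq_mul_integral
      (measurable_pi_apply i).aestronglyMeasurable (measurable_pi_apply j).aestronglyMeasurable
    rw [h2]
    have h3 : ∫ x : Fin d → ℝ, x i ∂Measure.pi (fun _ => gaussianReal 0 (t - s).toNNReal) = 0 := by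
      rw [integral_comp_eval (μ := fun _ : Fin d => gaussianReal 0 (t - s).toNNReal)
        (f := fun x => x) (by fun_prop), integral_id_gaussianReal]
    rw [h3, zero_mul]

/-- A function of the increment is independent of the past. No integrability is asked for, as the
product formula for independent functions also holds with the default value of the integral. -/
lemma IsBrownianMotion.integral_mul_increment (hW : IsBrownianMotion P 𝓕 T W) {s t : ℝ}
    (hs : 0 ≤ s) (hst : s ≤ t) (ht : t ≤ T) {f : Ω → ℝ} (hf : StronglyMeasurable[𝓕 s] f)
    {φ : E d → ℝ} (hφ : Measurable φ) :
    ∫ ω, f ω * φ (W t ω - W s ω) ∂P = (∫ ω, f ω ∂P) * ∫ ω, φ (W t ω - W s ω) ∂P := by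
  have hm : Measurable fun ω => W t ω - W s ω :=
    (hW.stronglyMeasurable ⟨hs.trans hst, ht⟩).measurable.sub
      (hW.stronglyMeasurable ⟨hs, hst.trans ht⟩).measurable
  have hind : IndepFun f (fun ω => φ (W t ω - W s ω)) P := by
    rw [IndepFun_iff_Indep]
    refine indep_of_indep_of_le_left (indep_of_indep_of_le_right (hW.indep s t hs hst ht) ?_)
      hf.measurable.comap_le
    exact (hφ.comp (comap_measurable fun ω => W t ω - W s ω)).comap_le
  exact hind.integral_fun_mul_eq_mul_integral (hf.mono (𝓕.le s)).aestronglyMeasurable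
    (hφ.comp hm).aestronglyMeasurable

lemma memLp_bounded_mul {f h : Ω → ℝ} {K : ℝ} (hf : StronglyMeasurable f)
    (hK : ∀ ω, |f ω| ≤ K) (hh : MemLp h 2 P) : MemLp (fun ω => f ω * h ω) 2 P :=
  hh.of_le_mul (c := K) (hf.aestronglyMeasurable.mul hh.1) <| ae_of_all _ fun ω => by
    simpa [abs_mul] using mul_le_mul_of_nonneg_right (hK ω) (abs_nonneg _)

lemma inner_eq_sum (x y : E d) : inner ℝ x y = ∑ i, x i * y i := by
  simp [PiLp.inner_apply, mul_comm]

lemma stronglyMeasurable_apply {m : MeasurableSpace Ω} {ξ : Ω → E d} (hξ : StronglyMeasurable ξ)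
    (i : Fin d) : StronglyMeasurable fun ω => ξ ω i :=
  (EuclideanSpace.proj (𝕜 := ℝ) i).continuous.comp_stronglyMeasurable hξ

lemma abs_apply_le {ξ : Ω → E d} {K : ℝ} (hK : ∀ ω, ‖ξ ω‖ ≤ K) (i : Fin d) (ω : Ω) :
    |ξ ω i| ≤ K :=
  (PiLp.norm_apply_le (ξ ω) i).trans (hK ω)

lemma IsBrownianMotion.memLp_inner_increment (hW : IsBrownianMotion P 𝓕 T W) {s t : ℝ}
    (hs : 0 ≤ s) (hst : s ≤ t) (ht : t ≤ T) {ξ : Ω → E d} (hξ : StronglyMeasurable ξ)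
    {K : ℝ} (hK : ∀ ω, ‖ξ ω‖ ≤ K) :
    MemLp (fun ω => inner ℝ (ξ ω) (W t ω - W s ω)) 2 P := by
  simp only [inner_eq_sum]
  refine memLp_finsetSum _ fun i _ => ?_
  exact memLp_bounded_mul (stronglyMeasurable_apply hξ i) (abs_apply_le hK i)
    (hW.memLp_increment hs hst ht i)

/-- The martingale property: in each coordinate the factor from the past splits off and leaves a
centred increment. Square integrability of `f` is what allows the sum over coordinates to leave the
integral. -/
lemma IsBrownianMotion.integral_mul_inner_increment (hW : IsBrownianMotion P 𝓕 T W) {s t : ℝ}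
    (hs : 0 ≤ s) (hst : s ≤ t) (ht : t ≤ T) {f : Ω → ℝ} (hf : StronglyMeasurable[𝓕 s] f)
    (hf2 : MemLp f 2 P) {ξ : Ω → E d} (hξ : StronglyMeasurable[𝓕 s] ξ)
    {K : ℝ} (hK : ∀ ω, ‖ξ ω‖ ≤ K) :
    ∫ ω, f ω * inner ℝ (ξ ω) (W t ω - W s ω) ∂P = 0 := by
  simp only [inner_eq_sum, Finset.mul_sum]
  rw [integral_finsetSum]
  · refine Finset.sum_eq_zero fun i _ => ?_
    simp only [← mul_assoc]
    refine (hW.integral_mul_increment hs hst ht (hf.mul (stronglyMeasurable_apply hξ i))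
      (φ := fun x => x i) (by fun_prop)).trans ?_
    simp only [PiLp.sub_apply]
    rw [hW.integral_increment hs hst ht i, mul_zero]
  · intro i _
    exact hf2.integrable_mul (memLp_bounded_mul
      (stronglyMeasurable_apply (hξ.mono (𝓕.le s)) i) (abs_apply_le hK i)
      (hW.memLp_increment hs hst ht i))

lemma IsBrownianMotion.integral_inner_increment_mul_self [IsFiniteMeasure P]
    (hW : IsBrownianMotion P 𝓕 T W)
    {s t : ℝ} (hs : 0 ≤ s) (hst : s ≤ t) (ht : t ≤ T) {ξ η : Ω → E d}
    (hξ : StronglyMeasurable[𝓕 s] ξ) {K : ℝ} (hK : ∀ ω, ‖ξ ω‖ ≤ K)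
    (hη : StronglyMeasurable[𝓕 s] η) {L : ℝ} (hL : ∀ ω, ‖η ω‖ ≤ L) :
    ∫ ω, inner ℝ (ξ ω) (W t ω - W s ω) * inner ℝ (η ω) (W t ω - W s ω) ∂P
      = (t - s) * ∫ ω, inner ℝ (ξ ω) (η ω) ∂P := by
  have hint : ∀ i j, Integrable (fun ω => (ξ ω i * (W t ω i - W s ω i))
      * (η ω j * (W t ω j - W s ω j))) P := fun i j =>
    (memLp_bounded_mul (stronglyMeasurable_apply (hξ.mono (𝓕.le s)) i) (abs_apply_le hK i)
      (hW.memLp_increment hs hst ht i)).integrable_mul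
    (memLp_bounded_mul (stronglyMeasurable_apply (hη.mono (𝓕.le s)) j) (abs_apply_le hL j)
      (hW.memLp_increment hs hst ht j))
  simp only [inner_eq_sum, Finset.sum_mul_sum, PiLp.sub_apply]
  rw [integral_finsetSum _ fun i _ => integrable_finsetSum _ fun j _ => hint i j]
  have hxy : ∀ i, Integrable (fun ω => ξ ω i * η ω i) P := fun i => by
    refine Integrable.of_bound (C := K * L) ?_ (ae_of_all _ fun ω => ?_)
    · exact ((stronglyMeasurable_apply (hξ.mono (𝓕.le s)) i).mul
        (stronglyMeasurable_apply (hη.mono (𝓕.le s)) i)).aestronglyMeasurable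
    · rw [norm_mul]
      exact mul_le_mul (abs_apply_le hK i ω) (abs_apply_le hL i ω) (abs_nonneg _)
        ((abs_nonneg _).trans (abs_apply_le hK i ω))
  rw [integral_finsetSum _ fun i _ => hxy i, Finset.mul_sum]
  refine Finset.sum_congr rfl fun i _ => ?_
  rw [integral_finsetSum _ fun j _ => hint i j]
  have hterm : ∀ j, ∫ ω, (ξ ω i * (W t ω i - W s ω i)) * (η ω j * (W t ω j - W s ω j)) ∂P
      = (∫ ω, ξ ω i * η ω j ∂P) * if i = j then t - s else 0 := fun j => by
    rw [← hW.integral_increment_mul hs hst ht i j]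
    refine Eq.trans (integral_congr_ae (ae_of_all _ fun ω => ?_))
      (hW.integral_mul_increment hs hst ht
        ((stronglyMeasurable_apply hξ i).mul (stronglyMeasurable_apply hη j))
        (φ := fun x => x i * x j) (by fun_prop))
    simp only [PiLp.sub_apply, Pi.mul_apply]
    ring
  rw [Finset.sum_congr rfl fun j _ => hterm j]
  simp [mul_comm (t - s)]

/-- The covariance of two elementary stochastic integrals, if the first interval starts first. -/
lemma IsBrownianMotion.integral_inner_increment_mul_of_le [IsFiniteMeasure P]
    (hW : IsBrownianMotion P 𝓕 T W) {a a' c c' : ℝ} (ha : 0 ≤ a) (haa : a ≤ a') (haT : a' ≤ T)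
    (hac : a ≤ c) (hcc : c ≤ c') (hcT : c' ≤ T) {ξ η : Ω → E d}
    (hξ : StronglyMeasurable[𝓕 a] ξ) {K : ℝ} (hK : ∀ ω, ‖ξ ω‖ ≤ K)
    (hη : StronglyMeasurable[𝓕 c] η) {L : ℝ} (hL : ∀ ω, ‖η ω‖ ≤ L) :
    ∫ ω, inner ℝ (ξ ω) (W a' ω - W a ω) * inner ℝ (η ω) (W c' ω - W c ω) ∂P
      = volume.real (Ioc a a' ∩ Ioc c c') * ∫ ω, inner ℝ (ξ ω) (η ω) ∂P := by
  have hc : 0 ≤ c := ha.trans hac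
  have hξ0 := hξ.mono (𝓕.le a)
  have hη0 := hη.mono (𝓕.le c)
  have hsm : ∀ {r s t : ℝ}, a ≤ r → 0 ≤ s → s ≤ r → 0 ≤ t → t ≤ r → r ≤ T →
      StronglyMeasurable[𝓕 r] fun ω => inner ℝ (ξ ω) (W t ω - W s ω) := fun {r s t} h1 h2 h3 h4 h5 h6 =>
    (hξ.mono (𝓕.mono h1)).inner (((hW.adapted t ⟨h4, h5.trans h6⟩).mono (𝓕.mono h5)).sub
      ((hW.adapted s ⟨h2, h3.trans h6⟩).mono (𝓕.mono h3)))
  rcases le_total a' c with h | h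
  · have hempty : Ioc a a' ∩ Ioc c c' = ∅ := by
      ext x; simp only [mem_inter_iff, mem_Ioc, mem_empty_iff_false]; grind
    rw [hempty, measureReal_empty, zero_mul]
    exact hW.integral_mul_inner_increment hc hcc hcT (hsm hac ha hac (ha.trans haa) h (hcc.trans hcT))
      (hW.memLp_inner_increment ha haa haT hξ0 hK) hη hL
  have hsplit : ∀ {r s t : ℝ} {ζ : Ω → E d} (ω : Ω), inner ℝ (ζ ω) (W t ω - W r ω)
      = inner ℝ (ζ ω) (W s ω - W r ω) + inner ℝ (ζ ω) (W t ω - W s ω) := fun {r s t ζ} ω => by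
    rw [← inner_add_right]; congr 1; abel
  -- Cut the first interval at `c`. The piece before `c` belongs to the past of the second increment
  -- and contributes nothing.
  have hfirst : ∫ ω, inner ℝ (ξ ω) (W c ω - W a ω) * inner ℝ (η ω) (W c' ω - W c ω) ∂P = 0 :=
    hW.integral_mul_inner_increment hc hcc hcT (hsm hac ha hac hc le_rfl (hcc.trans hcT))
      (hW.memLp_inner_increment ha hac (hcc.trans hcT) hξ0 hK) hη hL
  -- Now both intervals start at `c`. The longer one is cut where the shorter one ends, and the
  -- overhang is a future increment, orthogonal to the rest.
  have hmain : ∫ ω, inner ℝ (ξ ω) (W a' ω - W c ω) * inner ℝ (η ω) (W c' ω - W c ω) ∂P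
      = (min a' c' - c) * ∫ ω, inner ℝ (ξ ω) (η ω) ∂P := by
    rcases le_total a' c' with h' | h'
    · rw [min_eq_left h', ← hW.integral_inner_increment_mul_self hc h haT
        (hξ.mono (𝓕.mono hac)) hK hη hL]
      simp only [hsplit (r := c) (s := a') (t := c') (ζ := η), mul_add]
      rw [integral_add]
      · rw [hW.integral_mul_inner_increment (h.trans' hc) h' hcT
          (hsm haa hc h (hc.trans h) le_rfl haT)
          (hW.memLp_inner_increment hc h haT hξ0 hK) (hη.mono (𝓕.mono h)) hL, add_zero]
      · exact (hW.memLp_inner_increment hc h haT hξ0 hK).integrable_mul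
          (hW.memLp_inner_increment hc h haT hη0 hL)
      · exact (hW.memLp_inner_increment hc h haT hξ0 hK).integrable_mul
          (hW.memLp_inner_increment (hc.trans h) h' hcT hη0 hL)
    · rw [min_eq_right h', ← hW.integral_inner_increment_mul_self hc hcc hcT
        (hξ.mono (𝓕.mono hac)) hK hη hL]
      simp only [hsplit (r := c) (s := c') (t := a') (ζ := ξ), add_mul]
      rw [integral_add]
      · have h0 := hW.integral_mul_inner_increment (hcc.trans' hc) h' haT
          ((hη.mono (𝓕.mono hcc)).inner (((hW.adapted c' ⟨hc.trans hcc, hcT⟩)).sub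
            ((hW.adapted c ⟨hc, hcc.trans hcT⟩).mono (𝓕.mono hcc))))
          (hW.memLp_inner_increment hc hcc hcT hη0 hL) (hξ.mono (𝓕.mono (hac.trans hcc))) hK
        simp only [Pi.sub_apply] at h0
        simp only [mul_comm (inner ℝ (ξ _) (W a' _ - W c' _))]
        rw [h0, add_zero]
      · exact (hW.memLp_inner_increment hc hcc hcT hξ0 hK).integrable_mul
          (hW.memLp_inner_increment hc hcc hcT hη0 hL)
      · exact (hW.memLp_inner_increment (hc.trans hcc) h' haT hξ0 hK).integrable_mul
          (hW.memLp_inner_increment hc hcc hcT hη0 hL)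
  have hset : Ioc a a' ∩ Ioc c c' = Ioc c (min a' c') := by
    rw [Ioc_inter_Ioc, sup_eq_right.2 hac]
  rw [hset, Real.volume_real_Ioc_of_le (le_min h hcc), ← hmain]
  simp only [hsplit (r := a) (s := c) (t := a') (ζ := ξ), add_mul]
  rw [integral_add, hfirst, zero_add]
  · exact (hW.memLp_inner_increment ha hac (hcc.trans hcT) hξ0 hK).integrable_mul
      (hW.memLp_inner_increment hc hcc hcT hη0 hL)
  · exact (hW.memLp_inner_increment hc h haT hξ0 hK).integrable_mul
      (hW.memLp_inner_increment hc hcc hcT hη0 hL)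

/-- The covariance of two elementary stochastic integrals. -/
lemma IsBrownianMotion.integral_inner_increment_mul [IsFiniteMeasure P]
    (hW : IsBrownianMotion P 𝓕 T W) {a a' c c' : ℝ} (ha : 0 ≤ a) (haa : a ≤ a') (haT : a' ≤ T)
    (hc : 0 ≤ c) (hcc : c ≤ c') (hcT : c' ≤ T) {ξ η : Ω → E d}
    (hξ : StronglyMeasurable[𝓕 a] ξ) {K : ℝ} (hK : ∀ ω, ‖ξ ω‖ ≤ K)
    (hη : StronglyMeasurable[𝓕 c] η) {L : ℝ} (hL : ∀ ω, ‖η ω‖ ≤ L) :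
    ∫ ω, inner ℝ (ξ ω) (W a' ω - W a ω) * inner ℝ (η ω) (W c' ω - W c ω) ∂P
      = volume.real (Ioc a a' ∩ Ioc c c') * ∫ ω, inner ℝ (ξ ω) (η ω) ∂P := by
  rcases le_total a c with h | h
  · exact hW.integral_inner_increment_mul_of_le ha haa haT h hcc hcT hξ hK hη hL
  · have := hW.integral_inner_increment_mul_of_le hc hcc hcT h haa haT hη hL hξ hK
    rw [inter_comm]
    simp only [mul_comm (inner ℝ (ξ _) (W a' _ - W a _)), real_inner_comm (η _) (ξ _)]
    rw [this]

end Increments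

end CrossEntropy

namespace CrossEntropy

/-! ### Square-integrable functions -/

section L2

variable {α F : Type*} [MeasurableSpace α] {μ : Measure α} [NormedAddCommGroup F]

lemma eLpNorm_two_sq (f : α → F) : eLpNorm f 2 μ ^ 2 = ∫⁻ x, ‖f x‖ₑ ^ 2 ∂μ := by
  have h := eLpNorm_nnreal_pow_eq_lintegral (μ := μ) (f := f) (p := 2) two_ne_zero
  simpa using h

lemma tendsto_sq_zero_iff {f : ℕ → ℝ≥0∞} :
    Tendsto (fun k => f k ^ 2) atTop (𝓝 0) ↔ Tendsto f atTop (𝓝 0) := by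
  refine ⟨fun h => ?_, fun h => ?_⟩
  · have h2 := h.ennrpow_const (1 / 2)
    simp only [← ENNReal.rpow_natCast, ← ENNReal.rpow_mul] at h2
    simpa using h2
  · simpa using ENNReal.Tendsto.pow (n := 2) h

lemma eLpNorm_two_eq_of_integral_inner_eq {β G : Type*} [MeasurableSpace β] {ν : Measure β}
    [NormedAddCommGroup G] [InnerProductSpace ℝ G] [InnerProductSpace ℝ F] {f : α → F} {g : β → G}
    (hf : MemLp f 2 μ) (hg : MemLp g 2 ν)
    (h : ∫ x, inner ℝ (f x) (f x) ∂μ = ∫ y, inner ℝ (g y) (g y) ∂ν) :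
    eLpNorm f 2 μ = eLpNorm g 2 ν := by
  rw [hf.eLpNorm_eq_integral_rpow_norm (by simp) (by simp),
    hg.eLpNorm_eq_integral_rpow_norm (by simp) (by simp)]
  simp only [real_inner_self_eq_norm_sq] at h
  simp [h]

lemma integrable_inner_of_memLp [InnerProductSpace ℝ F] {f g : α → F} (hf : MemLp f 2 μ)
    (hg : MemLp g 2 μ) : Integrable (fun x => inner ℝ (f x) (g x)) μ :=
  (hf.norm.integrable_mul hg.norm).mono' (hf.1.inner hg.1)
    (ae_of_all _ fun _ => norm_inner_le_norm _ _)

/-- Completeness of `L²`, in the form needed for the Itô integral: `B k` will be the distance of the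
`k`-th simple integrand from its limit. -/
lemma exists_memLp_two_tendsto [CompleteSpace F] {f : ℕ → α → F} (hf : ∀ k, MemLp (f k) 2 μ)
    {B : ℕ → ℝ≥0∞} (hB : Tendsto B atTop (𝓝 0))
    (h : ∀ k l, eLpNorm (f k - f l) 2 μ ≤ B k + B l) :
    ∃ g, MemLp g 2 μ ∧ Tendsto (fun k => eLpNorm (f k - g) 2 μ) atTop (𝓝 0) := by
  have hc : CauchySeq fun k => (hf k).toLp (f k) := by
    refine EMetric.cauchySeq_iff.2 fun ε hε => ?_
    obtain ⟨N, hN⟩ := eventually_atTop.1 (hB.eventually (gt_mem_nhds (ENNReal.half_pos hε.ne')))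
    refine ⟨N, fun k hk l hl => ?_⟩
    rw [Lp.edist_toLp_toLp]
    calc _ ≤ B k + B l := h k l
      _ < ε / 2 + ε / 2 := ENNReal.add_lt_add (hN k hk) (hN l hl)
      _ = ε := ENNReal.add_halves ε
  obtain ⟨g, hg⟩ := cauchySeq_tendsto_of_complete hc
  refine ⟨g, Lp.memLp g, ?_⟩
  rw [Lp.tendsto_Lp_iff_tendsto_eLpNorm'] at hg
  refine hg.congr fun k => eLpNorm_congr_ae ?_
  filter_upwards [(hf k).coeFn_toLp] with x hx
  simp [hx]

end L2

/-! ### The Itô isometry and the graph of the Itô integral -/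

section Ito

variable {Ω : Type*} {mΩ : MeasurableSpace Ω} {P : Measure Ω} {𝓕 : Filtration ℝ mΩ} {d : ℕ}
  {T : ℝ} {W : ℝ → Ω → E d}

/-- The measure `dt ⊗ P` on `[0, T] × Ω`. -/
noncomputable abbrev timeProd (P : Measure Ω) (T : ℝ) : Measure (ℝ × Ω) :=
  (volume.restrict (Icc 0 T)).prod P

/-- The space of pairs of a simple integrand and its elementary integral. -/
def elemSpace (𝓕 : Filtration ℝ mΩ) (T : ℝ) (W : ℝ → Ω → E d) :
    Submodule ℝ ((ℝ × Ω → E d) × (Ω → ℝ)) :=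
  Submodule.span ℝ {p | ∃ (a b : ℝ) (ξ : Ω → E d), 0 ≤ a ∧ a ≤ b ∧ b ≤ T ∧
    StronglyMeasurable[𝓕 a] ξ ∧ (∃ K : ℝ, ∀ ω, ‖ξ ω‖ ≤ K) ∧
    p = (fun z => (Ioc a b).indicator (fun _ => ξ z.2) z.1,
      fun ω => inner ℝ (ξ ω) (W b ω - W a ω))}

/-- Simple processes on different partitions are awkward to add, whereas the span is linear by
construction. The integrand is recorded together with its integral, so the integral never has to be
shown to depend on the integrand alone. -/
lemma SimpleProcess.mem_elemSpace (S : SimpleProcess 𝓕 T d) (W : ℝ → Ω → E d) :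
    (fun z => S.value z.1 z.2, S.integral W) ∈ elemSpace 𝓕 T W := by
  have h : ((fun z => S.value z.1 z.2, S.integral W) : (ℝ × Ω → E d) × (Ω → ℝ))
      = ∑ i ∈ Finset.range S.n,
        (fun z => (Ioc (S.τ i) (S.τ (i + 1))).indicator (fun _ => S.ξ i z.2) z.1,
          fun ω => inner ℝ (S.ξ i ω) (W (S.τ (i + 1)) ω - W (S.τ i) ω)) := by
    ext z
    · simp [SimpleProcess.value, Prod.fst_sum, Finset.sum_apply]
    · simp [SimpleProcess.integral, Prod.snd_sum, Finset.sum_apply]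
  rw [h]
  exact Submodule.sum_mem _ fun i _ => Submodule.subset_span
    ⟨S.τ i, S.τ (i + 1), S.ξ i, (S.mem i).1, S.monotone (Nat.le_succ i), (S.mem _).2,
      S.measurable i, S.bounded i, rfl⟩

lemma elem_integrand_eq (a b : ℝ) (ξ : Ω → E d) :
    (fun z : ℝ × Ω => (Ioc a b).indicator (fun _ => ξ z.2) z.1)
      = (Ioc a b ×ˢ univ).indicator fun z => ξ z.2 := by
  ext z
  by_cases h : z.1 ∈ Ioc a b <;> simp [indicator, h]

lemma stronglyMeasurable_elem_integrand (a b : ℝ) {ξ : Ω → E d} (hξ : StronglyMeasurable ξ) :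
    StronglyMeasurable fun z : ℝ × Ω => (Ioc a b).indicator (fun _ => ξ z.2) z.1 := by
  have h := elem_integrand_eq a b ξ
  rw [h]
  exact (hξ.comp_measurable measurable_snd).indicator (measurableSet_Ioc.prod MeasurableSet.univ)

lemma memLp_of_mem_elemSpace [IsFiniteMeasure P] (hW : IsBrownianMotion P 𝓕 T W)
    {p : (ℝ × Ω → E d) × (Ω → ℝ)} (hp : p ∈ elemSpace 𝓕 T W) :
    MemLp p.1 2 (timeProd P T) ∧ MemLp p.2 2 P := by
  induction hp using Submodule.span_induction with
  | mem p hp =>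
    obtain ⟨a, b, ξ, ha, hab, hb, hξ, ⟨K, hK⟩, rfl⟩ := hp
    have hξ0 := hξ.mono (𝓕.le a)
    refine ⟨?_, hW.memLp_inner_increment ha hab hb hξ0 hK⟩
    have hb : ∀ z : ℝ × Ω, ‖(Ioc a b).indicator (fun _ => ξ z.2) z.1‖ ≤ K := fun z =>
      (norm_indicator_le_norm_self (fun _ => ξ z.2) z.1).trans (hK z.2)
    exact MemLp.of_bound (stronglyMeasurable_elem_integrand a b hξ0).aestronglyMeasurable K
      (ae_of_all _ hb)
  | zero => exact ⟨MemLp.zero, MemLp.zero⟩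
  | add p q _ _ hp hq => exact ⟨hp.1.add hq.1, hp.2.add hq.2⟩
  | smul c p _ hp => exact ⟨hp.1.const_smul c, hp.2.const_smul c⟩

/-- The polarized isometry. Both sides are bilinear, so induction over the span in each argument
leaves two elementary integrands, where the covariance is known; the statement for norms alone would
not pass through sums. -/
lemma integral_mul_eq_of_mem_elemSpace [IsFiniteMeasure P] (hW : IsBrownianMotion P 𝓕 T W)
    {p q : (ℝ × Ω → E d) × (Ω → ℝ)} (hp : p ∈ elemSpace 𝓕 T W) (hq : q ∈ elemSpace 𝓕 T W) :
    ∫ ω, p.2 ω * q.2 ω ∂P = ∫ z, inner ℝ (p.1 z) (q.1 z) ∂(timeProd P T) := by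
  have hi1 : ∀ {p q : (ℝ × Ω → E d) × (Ω → ℝ)}, p ∈ elemSpace 𝓕 T W → q ∈ elemSpace 𝓕 T W →
      Integrable (fun ω => p.2 ω * q.2 ω) P := fun hp hq =>
    (memLp_of_mem_elemSpace hW hp).2.integrable_mul (memLp_of_mem_elemSpace hW hq).2
  have hi2 : ∀ {p q : (ℝ × Ω → E d) × (Ω → ℝ)}, p ∈ elemSpace 𝓕 T W → q ∈ elemSpace 𝓕 T W →
      Integrable (fun z => inner ℝ (p.1 z) (q.1 z)) (timeProd P T) := fun hp hq =>
    integrable_inner_of_memLp (memLp_of_mem_elemSpace hW hp).1 (memLp_of_mem_elemSpace hW hq).1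
  induction hp, hq using Submodule.span_induction₂ with
  | mem_mem p q hp hq =>
    obtain ⟨a, b, ξ, ha, hab, hb, hξ, ⟨K, hK⟩, rfl⟩ := hp
    obtain ⟨c, e, η, hc, hce, he, hη, ⟨L, hL⟩, rfl⟩ := hq
    rw [hW.integral_inner_increment_mul ha hab hb hc hce he hξ hK hη hL]
    have hfun : (fun z : ℝ × Ω => inner ℝ ((Ioc a b).indicator (fun _ => ξ z.2) z.1)
        ((Ioc c e).indicator (fun _ => η z.2) z.1))
        = fun z => (Ioc a b ∩ Ioc c e).indicator (fun _ => (1 : ℝ)) z.1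
          * inner ℝ (ξ z.2) (η z.2) := by
      ext z
      by_cases h1 : z.1 ∈ Ioc a b <;> by_cases h2 : z.1 ∈ Ioc c e <;> simp [h1, h2]
    simp only [hfun]
    rw [integral_prod_mul (fun t => (Ioc a b ∩ Ioc c e).indicator (fun _ => (1 : ℝ)) t)
      (fun ω => inner ℝ (ξ ω) (η ω)), integral_indicator_const _
      (measurableSet_Ioc.inter measurableSet_Ioc), measureReal_restrict_apply
      (measurableSet_Ioc.inter measurableSet_Ioc)]
    have hsub : Ioc a b ∩ Ioc c e ⊆ Icc 0 T := fun x hx =>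
      ⟨ha.trans hx.1.1.le, hx.1.2.trans hb⟩
    rw [inter_eq_left.2 hsub, smul_eq_mul, mul_one]
  | zero_left => simp
  | zero_right => simp
  | add_left p q r hp hq hr h1 h2 =>
    simp only [Prod.fst_add, Prod.snd_add, Pi.add_apply, add_mul, inner_add_left]
    rw [integral_add (hi1 hp hr) (hi1 hq hr), integral_add (hi2 hp hr) (hi2 hq hr), h1, h2]
  | add_right p q r hp hq hr h1 h2 =>
    simp only [Prod.fst_add, Prod.snd_add, Pi.add_apply, mul_add, inner_add_right]
    rw [integral_add (hi1 hp hq) (hi1 hp hr), integral_add (hi2 hp hq) (hi2 hp hr), h1, h2]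
  | smul_left c p q hp hq h =>
    simp only [Prod.smul_fst, Prod.smul_snd, Pi.smul_apply, smul_eq_mul, mul_assoc,
      real_inner_smul_left, integral_const_mul, h]
  | smul_right c p q hp hq h =>
    simp only [Prod.smul_fst, Prod.smul_snd, Pi.smul_apply, smul_eq_mul, mul_left_comm _ c,
      real_inner_smul_right, integral_const_mul, h]

/-- The Itô isometry for simple integrands. -/
lemma eLpNorm_eq_of_mem_elemSpace [IsFiniteMeasure P] (hW : IsBrownianMotion P 𝓕 T W)
    {p : (ℝ × Ω → E d) × (Ω → ℝ)} (hp : p ∈ elemSpace 𝓕 T W) :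
    eLpNorm p.2 2 P = eLpNorm p.1 2 (timeProd P T) :=
  have hm := memLp_of_mem_elemSpace hW hp
  eLpNorm_two_eq_of_integral_inner_eq hm.2 hm.1 <| by
    simpa [pow_two] using integral_mul_eq_of_mem_elemSpace hW hp hp

/-- The graph of the Itô integral: the `L²`-closure of `elemSpace`. -/
def itoGraph (P : Measure Ω) [IsFiniteMeasure P] (hW : IsBrownianMotion P 𝓕 T W) :
    Submodule ℝ ((ℝ × Ω → E d) × (Ω → ℝ)) where
  carrier := {q | AEStronglyMeasurable q.1 (timeProd P T) ∧ AEStronglyMeasurable q.2 P ∧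
    ∃ p : ℕ → (ℝ × Ω → E d) × (Ω → ℝ), (∀ k, p k ∈ elemSpace 𝓕 T W) ∧
      Tendsto (fun k => eLpNorm ((p k).1 - q.1) 2 (timeProd P T)) atTop (𝓝 0) ∧
      Tendsto (fun k => eLpNorm ((p k).2 - q.2) 2 P) atTop (𝓝 0)}
  zero_mem' := ⟨aestronglyMeasurable_zero, aestronglyMeasurable_zero, 0,
    fun _ => Submodule.zero_mem _, by simp, by simp⟩
  add_mem' := by
    rintro q r ⟨hq1, hq2, p, hp, h1, h2⟩ ⟨hr1, hr2, p', hp', h1', h2'⟩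
    refine ⟨hq1.add hr1, hq2.add hr2, p + p', fun k => add_mem (hp k) (hp' k), ?_, ?_⟩
    · refine tendsto_of_tendsto_of_tendsto_of_le_of_le tendsto_const_nhds
        (by simpa using h1.add h1') (fun _ => zero_le) fun k => ?_
      have : ((p + p') k).1 - (q + r).1 = ((p k).1 - q.1) + ((p' k).1 - r.1) := by
        simp only [Pi.add_apply, Prod.fst_add]; abel
      rw [this]
      exact eLpNorm_add_le ((memLp_of_mem_elemSpace hW (hp k)).1.1.sub hq1)
        ((memLp_of_mem_elemSpace hW (hp' k)).1.1.sub hr1) (by norm_num)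
    · refine tendsto_of_tendsto_of_tendsto_of_le_of_le tendsto_const_nhds
        (by simpa using h2.add h2') (fun _ => zero_le) fun k => ?_
      have : ((p + p') k).2 - (q + r).2 = ((p k).2 - q.2) + ((p' k).2 - r.2) := by
        simp only [Pi.add_apply, Prod.snd_add]; abel
      rw [this]
      exact eLpNorm_add_le ((memLp_of_mem_elemSpace hW (hp k)).2.1.sub hq2)
        ((memLp_of_mem_elemSpace hW (hp' k)).2.1.sub hr2) (by norm_num)
  smul_mem' := by
    rintro c q ⟨hq1, hq2, p, hp, h1, h2⟩
    refine ⟨hq1.const_smul c, hq2.const_smul c, c • p,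
      fun k => Submodule.smul_mem _ c (hp k), ?_, ?_⟩
    · have : ∀ k, ((c • p) k).1 - (c • q).1 = c • ((p k).1 - q.1) := fun k => by
        simp only [Pi.smul_apply, Prod.smul_fst, smul_sub]
      simp only [this, eLpNorm_const_smul]
      simpa using ENNReal.Tendsto.const_mul h1 (Or.inr (enorm_ne_top (x := c)))
    · have : ∀ k, ((c • p) k).2 - (c • q).2 = c • ((p k).2 - q.2) := fun k => by
        simp only [Pi.smul_apply, Prod.smul_snd, smul_sub]
      simp only [this, eLpNorm_const_smul]
      simpa using ENNReal.Tendsto.const_mul h2 (Or.inr (enorm_ne_top (x := c)))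

lemma stochIntegral_spec {Z H : ℝ → Ω → E d} {Y : Ω → ℝ} (h : IsStochIntegral P 𝓕 T Z H Y) :
    IsStochIntegral P 𝓕 T Z H (stochIntegral P 𝓕 T Z H) := by
  have h' : ∃ Y, IsStochIntegral P 𝓕 T Z H Y := ⟨Y, h⟩
  rw [stochIntegral, dif_pos h']
  exact h'.choose_spec

lemma stronglyMeasurable_stochIntegral {Z H : ℝ → Ω → E d} :
    StronglyMeasurable (stochIntegral P 𝓕 T Z H) := by
  rw [stochIntegral]
  split_ifs with h
  · exact h.choose_spec.1
  · exact stronglyMeasurable_zero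

variable [IsFiniteMeasure P]

/-- The Itô isometry. -/
lemma eLpNorm_le_of_mem_itoGraph (hW : IsBrownianMotion P 𝓕 T W)
    {q : (ℝ × Ω → E d) × (Ω → ℝ)} (hq : q ∈ itoGraph P hW) :
    eLpNorm q.2 2 P ≤ eLpNorm q.1 2 (timeProd P T) := by
  obtain ⟨hq1, hq2, p, hp, h1, h2⟩ := hq
  have hlim : Tendsto (fun k => eLpNorm ((p k).2 - q.2) 2 P
      + (eLpNorm ((p k).1 - q.1) 2 (timeProd P T) + eLpNorm q.1 2 (timeProd P T))) atTop
      (𝓝 (0 + (0 + eLpNorm q.1 2 (timeProd P T)))) := h2.add (h1.add tendsto_const_nhds)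
  rw [zero_add, zero_add] at hlim
  refine ge_of_tendsto' hlim fun k => ?_
  have hm := memLp_of_mem_elemSpace hW (hp k)
  calc eLpNorm q.2 2 P = eLpNorm ((q.2 - (p k).2) + (p k).2) 2 P := by rw [sub_add_cancel]
    _ ≤ eLpNorm (q.2 - (p k).2) 2 P + eLpNorm (p k).2 2 P :=
      eLpNorm_add_le (hq2.sub hm.2.1) hm.2.1 (by norm_num)
    _ = eLpNorm ((p k).2 - q.2) 2 P + eLpNorm (((p k).1 - q.1) + q.1) 2 (timeProd P T) := by
      rw [eLpNorm_sub_comm, eLpNorm_eq_of_mem_elemSpace hW (hp k), sub_add_cancel]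
    _ ≤ _ := by
      gcongr
      exact eLpNorm_add_le (hm.1.1.sub hq1) hq1 (by norm_num)

lemma memLp_of_mem_itoGraph (hW : IsBrownianMotion P 𝓕 T W)
    {q : (ℝ × Ω → E d) × (Ω → ℝ)} (hq : q ∈ itoGraph P hW) (h : MemLp q.1 2 (timeProd P T)) :
    MemLp q.2 2 P :=
  ⟨hq.2.1, (eLpNorm_le_of_mem_itoGraph hW hq).trans_lt h.2⟩

/-- The difference lies in the submodule and has integrand zero, so the isometry makes its integral
vanish. Independence of the approximation, linearity and the value on constants all come from here.
-/
lemma ae_eq_of_mem_itoGraph (hW : IsBrownianMotion P 𝓕 T W) {q r : (ℝ × Ω → E d) × (Ω → ℝ)}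
    (hq : q ∈ itoGraph P hW) (hr : r ∈ itoGraph P hW) (h : q.1 =ᵐ[timeProd P T] r.1) :
    q.2 =ᵐ[P] r.2 := by
  have h1 := eLpNorm_le_of_mem_itoGraph hW (sub_mem hq hr)
  have h2 : eLpNorm (q - r).1 2 (timeProd P T) = 0 := by
    rw [eLpNorm_congr_ae (g := 0), eLpNorm_zero]
    filter_upwards [h] with z hz
    simp [hz]
  rw [h2, nonpos_iff_eq_zero, Prod.snd_sub,
    eLpNorm_eq_zero_iff (hq.2.1.sub hr.2.1) (by simp)] at h1
  filter_upwards [h1] with ω hω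
  simpa [sub_eq_zero] using hω

lemma exists_mem_itoGraph (hW : IsBrownianMotion P 𝓕 T W) {H : ℝ × Ω → E d}
    (hH : AEStronglyMeasurable H (timeProd P T)) {p : ℕ → (ℝ × Ω → E d) × (Ω → ℝ)}
    (hp : ∀ k, p k ∈ elemSpace 𝓕 T W)
    (h : Tendsto (fun k => eLpNorm ((p k).1 - H) 2 (timeProd P T)) atTop (𝓝 0)) :
    ∃ Y, (H, Y) ∈ itoGraph P hW ∧ Tendsto (fun k => eLpNorm ((p k).2 - Y) 2 P) atTop (𝓝 0) := by
  obtain ⟨Y, hY, hlim⟩ := exists_memLp_two_tendsto (μ := P) (f := fun k => (p k).2)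
    (fun k => (memLp_of_mem_elemSpace hW (hp k)).2) h fun k l => by
      have h1 := eLpNorm_eq_of_mem_elemSpace hW (sub_mem (hp k) (hp l))
      simp only [Prod.fst_sub, Prod.snd_sub] at h1
      rw [h1, eLpNorm_sub_comm (p l).1 H]
      have h2 : (p k).1 - (p l).1 = ((p k).1 - H) + (H - (p l).1) := by abel
      rw [h2, eLpNorm_sub_comm H (p l).1, eLpNorm_sub_comm (p l).1 H]
      exact eLpNorm_add_le ((memLp_of_mem_elemSpace hW (hp k)).1.1.sub hH)
        (hH.sub (memLp_of_mem_elemSpace hW (hp l)).1.1) (by norm_num)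
  exact ⟨Y, ⟨hH, hY.1, p, hp, h, hlim⟩, hlim⟩

lemma SimpleProcess.aestronglyMeasurable_value (hW : IsBrownianMotion P 𝓕 T W)
    (S : SimpleProcess 𝓕 T d) :
    AEStronglyMeasurable (fun z : ℝ × Ω => S.value z.1 z.2) (timeProd P T) :=
  (memLp_of_mem_elemSpace hW (S.mem_elemSpace W)).1.1

lemma eLpNorm_timeProd_sq {H : ℝ × Ω → E d} (hH : AEStronglyMeasurable H (timeProd P T)) :
    eLpNorm H 2 (timeProd P T) ^ 2 = ∫⁻ ω, (∫⁻ t in Icc 0 T, ‖H (t, ω)‖ₑ ^ 2) ∂P := by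
  rw [eLpNorm_two_sq, lintegral_prod_symm]
  exact (hH.enorm.pow_const 2)

/-- Tonelli: the iterated integral of the definition is the squared norm in `L²(dt ⊗ P)`, where the
triangle inequality is available. -/
lemma SimpleProcess.tendsto_iff (hW : IsBrownianMotion P 𝓕 T W) (S : ℕ → SimpleProcess 𝓕 T d)
    {H : ℝ → Ω → E d} (hH : AEStronglyMeasurable (fun z : ℝ × Ω => H z.1 z.2) (timeProd P T)) :
    Tendsto (fun k => ∫⁻ ω, (∫⁻ t in Icc 0 T, ‖(S k).value t ω - H t ω‖ₑ ^ 2) ∂P) atTop (𝓝 0)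
      ↔ Tendsto (fun k => eLpNorm ((fun z : ℝ × Ω => (S k).value z.1 z.2)
        - fun z : ℝ × Ω => H z.1 z.2) 2 (timeProd P T)) atTop (𝓝 0) := by
  rw [← tendsto_sq_zero_iff (f := fun k => eLpNorm _ 2 _)]
  refine iff_of_eq (congrArg (fun f => Tendsto f atTop (𝓝 0)) (funext fun k => ?_))
  rw [eLpNorm_timeProd_sq (((S k).aestronglyMeasurable_value hW).sub hH)]
  rfl

/-- Along every approximation in `L²` of the integrand by simple processes, the elementary
integrals converge in `L²` to the Itô integral. -/
lemma SimpleProcess.exists_integral_tendsto (hW : IsBrownianMotion P 𝓕 T W)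
    {H : ℝ → Ω → E d} (hH : AEStronglyMeasurable (fun z : ℝ × Ω => H z.1 z.2) (timeProd P T))
    {S : ℕ → SimpleProcess 𝓕 T d}
    (hS : Tendsto (fun k => ∫⁻ ω, (∫⁻ t in Icc 0 T, ‖(S k).value t ω - H t ω‖ₑ ^ 2) ∂P)
      atTop (𝓝 0)) :
    ∃ Y, (fun z => H z.1 z.2, Y) ∈ itoGraph P hW ∧
      TendstoInMeasure P (fun k => (S k).integral W) atTop Y := by
  obtain ⟨Y, hY, hlim⟩ := exists_mem_itoGraph hW hH (fun k => (S k).mem_elemSpace W)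
    ((SimpleProcess.tendsto_iff hW S hH).1 hS)
  exact ⟨Y, hY, tendstoInMeasure_of_tendsto_eLpNorm (by simp)
    (fun k => (memLp_of_mem_elemSpace hW ((S k).mem_elemSpace W)).2.1) hY.2.1 hlim⟩

/-- The definition asks only for convergence in probability, but the isometry provides an `L²` limit
along the same simple processes, and limits in measure are almost surely unique. -/
lemma IsStochIntegral.mem_itoGraph (hW : IsBrownianMotion P 𝓕 T W) {H : ℝ → Ω → E d}
    (hH : AEStronglyMeasurable (fun z : ℝ × Ω => H z.1 z.2) (timeProd P T)) {Y : Ω → ℝ}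
    (h : IsStochIntegral P 𝓕 T W H Y) : (fun z => H z.1 z.2, Y) ∈ itoGraph P hW := by
  obtain ⟨hY, S, hS, hlim⟩ := h
  obtain ⟨Y', ⟨h1, h2, p, hp, h3, h4⟩, hlim'⟩ := SimpleProcess.exists_integral_tendsto hW hH hS
  refine ⟨h1, hY.aestronglyMeasurable, p, hp, h3, h4.congr fun k => ?_⟩
  refine eLpNorm_congr_ae ?_
  filter_upwards [tendstoInMeasure_ae_unique hlim hlim'] with ω hω
  simp [hω]

lemma SimpleProcess.exists_isStochIntegral (hW : IsBrownianMotion P 𝓕 T W)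
    {H : ℝ → Ω → E d} (hH : AEStronglyMeasurable (fun z : ℝ × Ω => H z.1 z.2) (timeProd P T))
    {S : ℕ → SimpleProcess 𝓕 T d}
    (hS : Tendsto (fun k => ∫⁻ ω, (∫⁻ t in Icc 0 T, ‖(S k).value t ω - H t ω‖ₑ ^ 2) ∂P)
      atTop (𝓝 0)) : ∃ Y, IsStochIntegral P 𝓕 T W H Y := by
  obtain ⟨Y, hY, hlim⟩ := SimpleProcess.exists_integral_tendsto hW hH hS
  exact ⟨hY.2.1.mk Y, hY.2.1.stronglyMeasurable_mk, S, hS, hlim.congr_right hY.2.1.ae_eq_mk⟩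

end Ito

end CrossEntropy

namespace CrossEntropy

/-! ### Density of simple processes among the controls -/

section Averages

/-- Difference quotients over intervals that are comparably close to a point of
differentiability converge to the derivative. -/
lemma tendsto_quotient_of_hasDerivAt {F : Type*} [NormedAddCommGroup F] [NormedSpace ℝ F]
    {f : ℝ → F} {f' : F} {t : ℝ} (hf : HasDerivAt f f' t) {a b h : ℕ → ℝ}
    (hpos : ∀ n, 0 < h n) (hh : Tendsto h atTop (𝓝 0)) (hab : ∀ n, b n - a n = h n)
    (ha : ∀ n, |a n - t| ≤ 2 * h n) (hb : ∀ n, |b n - t| ≤ 2 * h n) :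
    Tendsto (fun n => (h n)⁻¹ • (f (b n) - f (a n))) atTop (𝓝 f') := by
  have key : ∀ c : ℕ → ℝ, (∀ n, |c n - t| ≤ 2 * h n) →
      (fun n => f (c n) - f t - (c n - t) • f') =o[atTop] h := fun c hc => by
    have hct : Tendsto c atTop (𝓝 t) := by
      rw [tendsto_iff_norm_sub_tendsto_zero]
      refine squeeze_zero (fun _ => norm_nonneg _) hc ?_
      simpa using hh.const_mul 2
    refine ((hasDerivAt_iff_isLittleO.1 hf).comp_tendsto hct).trans_isBigO ?_
    refine Asymptotics.IsBigO.of_bound 2 (Eventually.of_forall fun n => ?_)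
    simpa [abs_of_pos (hpos n)] using hc n
  have h1 := ((key b hb).sub (key a ha)).tendsto_inv_smul_nhds_zero
  have h2 : Tendsto (fun n => (h n)⁻¹ • (f (b n) - f t - (b n - t) • f'
      - (f (a n) - f t - (a n - t) • f')) + f') atTop (𝓝 f') := by
    simpa using h1.add_const f'
  refine h2.congr fun n => ?_
  have h3 : f (b n) - f t - (b n - t) • f' - (f (a n) - f t - (a n - t) • f')
      = (f (b n) - f (a n)) - h n • f' := by
    rw [← hab n]; module
  rw [h3, smul_sub, inv_smul_smul₀ (hpos n).ne', sub_add_cancel]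

end Averages

section Density

variable {Ω : Type*} {mΩ : MeasurableSpace Ω} {P : Measure Ω} {𝓕 : Filtration ℝ mΩ} {d : ℕ}
  {T : ℝ} {u : ℝ → Ω → E d}

lemma SimpleProcess.value_eq (S : SimpleProcess 𝓕 T d) {i : ℕ} (hi : i < S.n) {t : ℝ}
    (ht : t ∈ Ioc (S.τ i) (S.τ (i + 1))) (ω : Ω) : S.value t ω = S.ξ i ω := by
  rw [SimpleProcess.value, Finset.sum_eq_single_of_mem i (Finset.mem_range.2 hi), indicator_of_mem ht]
  intro j _ hj
  refine indicator_of_notMem (fun hj' => ?_) _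
  rcases lt_or_gt_of_ne hj with h | h
  · exact absurd (hj'.2.trans (S.monotone h)) (not_le.2 ht.1)
  · exact absurd (ht.2.trans (S.monotone h)) (not_le.2 hj'.1)

lemma SimpleProcess.norm_value_le (S : SimpleProcess 𝓕 T d) {K : ℝ} (hK : 0 ≤ K) {ω : Ω}
    (h : ∀ i, ‖S.ξ i ω‖ ≤ K) (t : ℝ) : ‖S.value t ω‖ ≤ K := by
  by_cases hex : ∃ i < S.n, t ∈ Ioc (S.τ i) (S.τ (i + 1))
  · obtain ⟨i, hi, ht⟩ := hex
    rw [S.value_eq hi ht]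
    exact h i
  · push Not at hex
    rw [SimpleProcess.value, Finset.sum_eq_zero fun i hi =>
      indicator_of_notMem (hex i (Finset.mem_range.1 hi)) _, norm_zero]
    exact hK

lemma SimpleProcess.stronglyMeasurable_value (S : SimpleProcess 𝓕 T d) :
    StronglyMeasurable fun z : ℝ × Ω => S.value z.1 z.2 := by
  refine Finset.stronglyMeasurable_fun_sum _ fun i _ => ?_
  exact stronglyMeasurable_elem_integrand _ _ ((S.measurable i).mono (𝓕.le _))

/-- The extension by zero is measurable for `𝓕 t`, not merely for the ambient σ-algebra. This is
what makes the averages in `avgProcess` adapted. -/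
lemma ProgressiveOn.stronglyMeasurable_indicator (hu : ProgressiveOn 𝓕 T u) {t : ℝ}
    (ht : t ∈ Icc 0 T) :
    StronglyMeasurable[MeasurableSpace.prod inferInstance (𝓕 t)]
      (fun z : ℝ × Ω => (Icc 0 t).indicator (fun s => u s z.2) z.1) := by
  have h : (fun z : ℝ × Ω => (Icc 0 t).indicator (fun s => u s z.2) z.1)
      = (Icc 0 t ×ˢ univ).indicator
        ((fun p : Icc (0 : ℝ) t × Ω => u p.1 p.2) ∘ fun z => (projIcc 0 t ht.1 z.1, z.2)) := by
    ext1 z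
    by_cases hz : z.1 ∈ Icc 0 t
    · rw [indicator_of_mem hz, indicator_of_mem (mem_prod.2 ⟨hz, mem_univ _⟩)]
      simp [projIcc_of_mem ht.1 hz]
    · rw [indicator_of_notMem hz, indicator_of_notMem (fun h => hz (mem_prod.1 h).1)]
  rw [h]
  let _ : MeasurableSpace Ω := 𝓕 t
  refine ((hu t ht).comp_measurable ?_).indicator (measurableSet_Icc.prod MeasurableSet.univ)
  exact (continuous_projIcc.measurable.comp measurable_fst).prodMk measurable_snd

lemma ProgressiveOn.stronglyMeasurable_extension (hu : ProgressiveOn 𝓕 T u) (hT : 0 ≤ T) :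
    StronglyMeasurable (fun z : ℝ × Ω => (Icc 0 T).indicator (fun s => u s z.2) z.1) := by
  refine (hu.stronglyMeasurable_indicator (t := T) ⟨hT, le_rfl⟩).mono ?_
  exact sup_le_sup le_rfl (MeasurableSpace.comap_mono (𝓕.le T))

lemma extension_ae_eq [SFinite P] (u : ℝ → Ω → E d) :
    (fun z : ℝ × Ω => (Icc 0 T).indicator (fun s => u s z.2) z.1)
      =ᵐ[timeProd P T] fun z => u z.1 z.2 := by
  have h : ∀ᵐ z ∂(timeProd P T), z.1 ∈ Icc 0 T :=
    Measure.quasiMeasurePreserving_fst.ae (ae_restrict_mem measurableSet_Icc)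
  filter_upwards [h] with z hz
  rw [indicator_of_mem hz]

lemma ProgressiveOn.aestronglyMeasurable [SFinite P] (hu : ProgressiveOn 𝓕 T u) (hT : 0 ≤ T) :
    AEStronglyMeasurable (fun z : ℝ × Ω => u z.1 z.2) (timeProd P T) :=
  (hu.stronglyMeasurable_extension hT).aestronglyMeasurable.congr (extension_ae_eq u)

lemma stronglyMeasurable_intervalIntegral {m : MeasurableSpace Ω} {f : ℝ × Ω → E d}
    (hf : StronglyMeasurable f) (a b : ℝ) :
    StronglyMeasurable fun ω => ∫ s in a..b, f (s, ω) := by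
  simp only [intervalIntegral]
  exact (StronglyMeasurable.integral_prod_left (f := fun s ω => f (s, ω)) hf).sub
    (StronglyMeasurable.integral_prod_left (f := fun s ω => f (s, ω)) hf)

lemma norm_average_le {f : ℝ → E d} {K h x : ℝ} (hh : 0 < h) (hf : ∀ s, ‖f s‖ ≤ K) :
    ‖h⁻¹ • ∫ s in (x - 1) * h..x * h, f s‖ ≤ K := by
  have h1 := intervalIntegral.norm_integral_le_of_norm_le_const
    (a := (x - 1) * h) (b := x * h) (C := K) (f := f) fun s _ => hf s
  have h2 : x * h - (x - 1) * h = h := by ring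
  rw [h2, abs_of_pos hh] at h1
  rw [norm_smul, norm_inv, Real.norm_of_nonneg hh.le, inv_mul_le_iff₀ hh]
  linarith

/-- The simple process that averages a bounded progressive process over the preceding interval
of a uniform partition. -/
noncomputable def avgProcess {K : ℝ} (hu : ProgressiveOn 𝓕 T u) (hK : ∀ s ω, ‖u s ω‖ ≤ K)
    (hT : 0 < T) (N : ℕ) : SimpleProcess 𝓕 T d where
  n := N + 1
  -- All indices, also those beyond `n`, must give times in `[0, T]`; hence the minimum.
  τ i := min (i * (T / (N + 1))) T
  -- The value on the cell after `τ i` is the average over the cell before it, hence known at time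
  -- `τ i`. For `i = 0` the integrand vanishes off one point, and the value is `0`.
  ξ i ω := (T / (N + 1))⁻¹ • ∫ s in ((i : ℝ) - 1) * (T / (N + 1))..i * (T / (N + 1)),
    (Icc 0 (min (i * (T / (N + 1))) T)).indicator (fun s => u s ω) s
  monotone i j hij := min_le_min_right T
    (mul_le_mul_of_nonneg_right (Nat.cast_le.2 hij) (by positivity))
  mem i := ⟨le_min (by positivity) hT.le, min_le_right _ _⟩
  measurable i := by
    have hi : min ((i : ℝ) * (T / (N + 1))) T ∈ Icc 0 T :=
      ⟨le_min (by positivity) hT.le, min_le_right _ _⟩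
    exact (stronglyMeasurable_intervalIntegral (m := 𝓕 _)
      (hu.stronglyMeasurable_indicator hi) _ _).fun_const_smul _
  bounded i := ⟨K, fun ω => norm_average_le (by positivity)
    fun s => (norm_indicator_le_norm_self _ _).trans (hK s ω)⟩

lemma exists_mesh {T t : ℝ} (hT : 0 < T) (ht : t ∈ Ioc 0 T) (N : ℕ) :
    ∃ i < N + 1, i * (T / (N + 1)) < t ∧ t ≤ (i + 1) * (T / (N + 1)) := by
  have hh : 0 < T / (N + 1) := by positivity
  have hN : (N + 1) * (T / (N + 1)) = T := by field_simp
  have hc : 0 < ⌈t / (T / (N + 1))⌉₊ := Nat.ceil_pos.2 (div_pos ht.1 hh)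
  obtain ⟨i, hi⟩ := Nat.exists_eq_succ_of_ne_zero hc.ne'
  have h1 : (i : ℝ) * (T / (N + 1)) < t := by
    rw [← lt_div_iff₀ hh]
    exact Nat.lt_ceil.1 (by omega)
  have h2 : t ≤ (i + 1) * (T / (N + 1)) := by
    rw [← div_le_iff₀ hh]
    have := Nat.le_ceil (t / (T / (N + 1)))
    rw [hi] at this
    simpa using this
  refine ⟨i, ?_, h1, h2⟩
  have h3 : (i : ℝ) * (T / (N + 1)) < (N + 1) * (T / (N + 1)) := by linarith [ht.2]
  have h4 := lt_of_mul_lt_mul_right h3 hh.le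
  exact_mod_cast h4

/-- Lebesgue differentiation along a fixed path. The averaging interval does not contain `t`, but
its distance from `t` is comparable to its length. -/
lemma avgProcess_tendsto {K : ℝ} (hu : ProgressiveOn 𝓕 T u) (hK : ∀ s ω, ‖u s ω‖ ≤ K)
    (hT : 0 < T) (ω : Ω) :
    ∀ᵐ t ∂(volume.restrict (Icc 0 T)),
      Tendsto (fun N => (avgProcess hu hK hT N).value t ω) atTop (𝓝 (u t ω)) := by
  set G : ℝ → E d := (Icc 0 T).indicator (fun s => u s ω) with hG
  have hGm : StronglyMeasurable G :=
    (hu.stronglyMeasurable_extension hT.le).comp_measurable (measurable_id.prodMk measurable_const)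
  have hGb : ∀ s, ‖G s‖ ≤ K := fun s => (norm_indicator_le_norm_self _ _).trans (hK s ω)
  have hGi : ∀ a b, IntervalIntegrable G volume a b := fun a b =>
    (intervalIntegrable_const (c := K)).mono_fun hGm.aestronglyMeasurable
      (ae_of_all _ fun s => (hGb s).trans (le_abs_self K))
  have hGl : LocallyIntegrable G volume := by
    refine locallyIntegrable_iff.2 fun k hk => ?_
    exact Measure.integrableOn_of_bounded hk.measure_lt_top.ne hGm.aestronglyMeasurable
      (ae_of_all _ hGb)
  -- The cells are left-open, so the time `0` lies in none of them.
  have h0 : ∀ᵐ t ∂(volume : Measure ℝ), t ≠ 0 := by simp [ae_iff, measure_singleton]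
  filter_upwards [ae_restrict_of_ae (LocallyIntegrable.ae_hasDerivAt_integral hGl),
    ae_restrict_of_ae h0, ae_restrict_mem measurableSet_Icc] with t hderiv ht0 htT
  have ht : t ∈ Ioc 0 T := ⟨lt_of_le_of_ne htT.1 (Ne.symm ht0), htT.2⟩
  choose i hi h1 h2 using exists_mesh hT ht
  have hpos : ∀ N : ℕ, 0 < T / ((N : ℝ) + 1) := fun N => by positivity
  have hlim : Tendsto (fun N : ℕ => T / ((N : ℝ) + 1)) atTop (𝓝 0) :=
    tendsto_const_div_atTop_nhds_zero_nat T |>.comp (tendsto_add_atTop_nat 1) |>.congr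
      fun N => by simp
  -- With `h` the mesh, `t` lies in `(i h, (i + 1) h]` and the average runs over `((i - 1) h, i h]`.
  -- Both endpoints are within `2 h` of `t`.
  have hq := tendsto_quotient_of_hasDerivAt (f := fun x => ∫ s in (0 : ℝ)..x, G s) (hderiv 0)
    (h := fun N : ℕ => T / ((N : ℝ) + 1))
    (a := fun N => ((i N : ℝ) - 1) * (T / (N + 1))) (b := fun N => i N * (T / (N + 1)))
    hpos hlim (fun N => by ring)
    (fun N => by have := h1 N; have := h2 N; have := hpos N; rw [abs_le]; constructor <;> linarith)
    (fun N => by have := h1 N; have := h2 N; have := hpos N; rw [abs_le]; constructor <;> linarith)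
  have hGt : G t = u t ω := indicator_of_mem htT _
  rw [hGt] at hq
  refine hq.congr fun N => ?_
  have hN : ((N : ℝ) + 1) * (T / (N + 1)) = T := by field_simp
  have hle : ((i N : ℝ) + 1) * (T / (N + 1)) ≤ T := by
    have h3 : (i N : ℝ) + 1 ≤ N + 1 := by exact_mod_cast hi N
    calc _ ≤ ((N : ℝ) + 1) * (T / (N + 1)) := by gcongr
      _ = T := hN
  have hle' : (i N : ℝ) * (T / (N + 1)) ≤ T := by linarith [hpos N]
  rw [SimpleProcess.value_eq _ (i := i N) (hi N)]
  · simp only [avgProcess]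
    rw [intervalIntegral.integral_interval_sub_left (hGi _ _) (hGi _ _), min_eq_left hle']
    congr 1
    -- Cutting off at `τ i` or at `T` makes no difference, as the interval of integration ends at `τ
    -- i`.
    refine intervalIntegral.integral_congr_ae (ae_of_all _ fun s hs => ?_)
    rw [uIoc_of_le (by linarith [hpos N])] at hs
    by_cases hs0 : 0 ≤ s
    · have m1 : s ∈ Icc 0 T := ⟨hs0, hs.2.trans hle'⟩
      have m2 : s ∈ Icc 0 ((i N : ℝ) * (T / (N + 1))) := ⟨hs0, hs.2⟩
      rw [hG, indicator_of_mem m1, indicator_of_mem m2]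
    · rw [hG, indicator_of_notMem (fun h => hs0 h.1), indicator_of_notMem (fun h => hs0 h.1)]
  · simp only [avgProcess]
    refine ⟨by rw [min_eq_left hle']; exact h1 N, ?_⟩
    push_cast
    rw [min_eq_left hle]
    exact h2 N

/-- Dominated convergence twice, in `t` for fixed `ω` and then in `ω`, with the bound `(2K)²`
because averaging does not increase the supremum. -/
lemma tendsto_avgProcess [IsFiniteMeasure P] {K : ℝ} (hu : ProgressiveOn 𝓕 T u)
    (hK : ∀ s ω, ‖u s ω‖ ≤ K) (hT : 0 < T) :
    Tendsto (fun N => ∫⁻ ω, (∫⁻ t in Icc 0 T,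
      ‖(avgProcess hu hK hT N).value t ω - u t ω‖ₑ ^ 2) ∂P) atTop (𝓝 0) := by
  set G : ℝ × Ω → E d := fun z => (Icc 0 T).indicator (fun s => u s z.2) z.1 with hG
  have hGm : StronglyMeasurable G := hu.stronglyMeasurable_extension hT.le
  have hmeas : ∀ N, Measurable fun z : ℝ × Ω =>
      ‖(avgProcess hu hK hT N).value z.1 z.2 - G z‖ₑ ^ 2 := fun N =>
    ((avgProcess hu hK hT N).stronglyMeasurable_value.sub hGm).enorm.pow_const 2
  have hsec : ∀ N ω, Measurable fun t =>
      ‖(avgProcess hu hK hT N).value t ω - G (t, ω)‖ₑ ^ 2 := fun N ω =>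
    Measurable.of_uncurry_right
      (f := fun t ω => ‖(avgProcess hu hK hT N).value t ω - G (t, ω)‖ₑ ^ 2) (hmeas N)
  have hcongr : ∀ N ω, ∫⁻ t in Icc 0 T, ‖(avgProcess hu hK hT N).value t ω - u t ω‖ₑ ^ 2
      = ∫⁻ t in Icc 0 T, ‖(avgProcess hu hK hT N).value t ω - G (t, ω)‖ₑ ^ 2 := fun N ω =>
    setLIntegral_congr_fun measurableSet_Icc fun t ht => by simp [hG, ht]
  have hbound : ∀ N ω t, ‖(avgProcess hu hK hT N).value t ω - G (t, ω)‖ₑ ^ 2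
      ≤ ENNReal.ofReal (2 * K) ^ 2 := fun N ω t => by
    gcongr
    rw [← ofReal_norm]
    refine ENNReal.ofReal_le_ofReal ?_
    have h1 := (avgProcess hu hK hT N).norm_value_le ((norm_nonneg _).trans (hK t ω)) (ω := ω)
      (fun i => norm_average_le (by positivity)
        fun s => (norm_indicator_le_norm_self _ _).trans (hK s ω)) t
    have h2 : ‖G (t, ω)‖ ≤ K := (norm_indicator_le_norm_self _ _).trans (hK t ω)
    linarith [norm_sub_le ((avgProcess hu hK hT N).value t ω) (G (t, ω))]
  simp only [hcongr]
  have hfin : ∫⁻ _ in Icc 0 T, ENNReal.ofReal (2 * K) ^ 2 ≠ ∞ := by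
    rw [lintegral_const]
    exact ENNReal.mul_ne_top (ENNReal.pow_ne_top ENNReal.ofReal_ne_top) (by simp)
  rw [← lintegral_zero (μ := P)]
  refine tendsto_lintegral_of_dominated_convergence
    (fun _ => ∫⁻ _ in Icc 0 T, ENNReal.ofReal (2 * K) ^ 2)
    (fun N => (hmeas N).lintegral_prod_left')
    (fun N => ae_of_all _ fun ω => lintegral_mono fun t => hbound N ω t) ?_
    (ae_of_all _ fun ω => ?_)
  · rw [lintegral_const]
    exact ENNReal.mul_ne_top hfin (measure_ne_top _ _)
  · rw [← lintegral_zero (μ := volume.restrict (Icc 0 T))]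
    refine tendsto_lintegral_of_dominated_convergence (fun _ => ENNReal.ofReal (2 * K) ^ 2)
      (fun N => hsec N ω)
      (fun N => ae_of_all _ fun t => hbound N ω t) hfin ?_
    filter_upwards [avgProcess_tendsto hu hK hT ω, ae_restrict_mem measurableSet_Icc] with t ht htT
    have hGt : G (t, ω) = u t ω := indicator_of_mem htT _
    rw [hGt]
    have h1 := (ht.sub_const (u t ω)).enorm
    rw [sub_self, enorm_zero] at h1
    simpa using ENNReal.Tendsto.pow (n := 2) h1

/-- The truncation of a vector at norm `K`. -/
noncomputable def truncate (K : ℝ) (x : E d) : E d := (Metric.closedBall 0 K).indicator id x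

lemma measurable_truncate (K : ℝ) : Measurable (truncate (d := d) K) :=
  measurable_id.indicator Metric.isClosed_closedBall.measurableSet

lemma norm_truncate_le {K : ℝ} (hK : 0 ≤ K) (x : E d) : ‖truncate K x‖ ≤ K := by
  by_cases h : x ∈ Metric.closedBall 0 K
  · rw [truncate, indicator_of_mem h]
    simpa using h
  · rwa [truncate, indicator_of_notMem h, norm_zero]

lemma norm_truncate_sub_le (K : ℝ) (x : E d) : ‖truncate K x - x‖ ≤ ‖x‖ := by
  by_cases h : x ∈ Metric.closedBall 0 K
  · rw [truncate, indicator_of_mem h]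
    simp
  · rw [truncate, indicator_of_notMem h, zero_sub, norm_neg]

lemma ProgressiveOn.comp_measurable (hu : ProgressiveOn 𝓕 T u) {c : E d → E d}
    (hc : Measurable c) : ProgressiveOn 𝓕 T fun s ω => c (u s ω) := fun t ht =>
  (hc.comp (hu t ht).measurable).stronglyMeasurable

/-- The truncation error is either `0` or `-u`, so `‖u‖²` dominates its square, and it vanishes as
soon as `k` exceeds `‖u‖`. -/
lemma tendsto_eLpNorm_truncate_sub [SFinite P] (hT : 0 ≤ T) (hu : u ∈ controls d P 𝓕 T) :
    Tendsto (fun k : ℕ => eLpNorm ((fun z : ℝ × Ω => truncate k (u z.1 z.2))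
      - fun z => u z.1 z.2) 2 (timeProd P T)) atTop (𝓝 0) := by
  have hm := hu.1.aestronglyMeasurable (P := P) hT
  rw [← tendsto_sq_zero_iff]
  simp only [eLpNorm_two_sq, Pi.sub_apply]
  rw [← lintegral_zero (μ := timeProd P T)]
  refine tendsto_lintegral_of_dominated_convergence' (fun z => ‖u z.1 z.2‖ₑ ^ 2)
    (fun k => ?_) (fun k => ae_of_all _ fun z => ?_) ?_ (ae_of_all _ fun z => ?_)
  · exact ((((measurable_truncate k).comp_aemeasurable hm.aemeasurable).sub
      hm.aemeasurable).enorm).pow_const 2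
  · exact pow_le_pow_left' (enorm_le_iff_norm_le.2 (norm_truncate_sub_le _ _)) 2
  · rw [lintegral_prod_symm _ (hm.enorm.pow_const 2)]
    exact hu.2.ne
  · refine tendsto_const_nhds.congr' ?_
    filter_upwards [eventually_ge_atTop ⌈‖u z.1 z.2‖⌉₊] with k hk
    have hmem : u z.1 z.2 ∈ Metric.closedBall 0 (k : ℝ) := by
      simpa using (Nat.le_ceil _).trans (Nat.cast_le.2 hk)
    rw [truncate, indicator_of_mem hmem]
    simp

/-- Simple processes are dense in the control space. -/
lemma exists_simpleProcess_tendsto [IsFiniteMeasure P] {W : ℝ → Ω → E d}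
    (hW : IsBrownianMotion P 𝓕 T W) (hT : 0 < T) (hu : u ∈ controls d P 𝓕 T) :
    ∃ S : ℕ → SimpleProcess 𝓕 T d, Tendsto (fun k => ∫⁻ ω,
      (∫⁻ t in Icc 0 T, ‖(S k).value t ω - u t ω‖ₑ ^ 2) ∂P) atTop (𝓝 0) := by
  have hm := hu.1.aestronglyMeasurable (P := P) hT.le
  have key : ∀ δ : ℝ≥0∞, 0 < δ → ∃ S : SimpleProcess 𝓕 T d,
      eLpNorm ((fun z : ℝ × Ω => S.value z.1 z.2) - fun z : ℝ × Ω => u z.1 z.2) 2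
        (timeProd P T) < δ := fun δ hδ => by
    -- Half of the tolerance is spent on truncation and half on averaging the truncated process.
    obtain ⟨K, hK⟩ := ((tendsto_eLpNorm_truncate_sub hT.le hu).eventually
      (gt_mem_nhds (ENNReal.half_pos hδ.ne'))).exists
    have hv := hu.1.comp_measurable (measurable_truncate (d := d) K)
    have hvm := hv.aestronglyMeasurable (P := P) hT.le
    have hb : ∀ s ω, ‖truncate K (u s ω)‖ ≤ K := fun s ω => norm_truncate_le K.cast_nonneg _
    obtain ⟨N, hN⟩ := (((SimpleProcess.tendsto_iff hW _ hvm).1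
      (tendsto_avgProcess (P := P) hv hb hT)).eventually
      (gt_mem_nhds (ENNReal.half_pos hδ.ne'))).exists
    refine ⟨avgProcess hv hb hT N, ?_⟩
    have hsplit : ((fun z : ℝ × Ω => (avgProcess hv hb hT N).value z.1 z.2)
        - fun z : ℝ × Ω => u z.1 z.2)
        = ((fun z : ℝ × Ω => (avgProcess hv hb hT N).value z.1 z.2)
          - fun z : ℝ × Ω => truncate K (u z.1 z.2))
          + ((fun z : ℝ × Ω => truncate K (u z.1 z.2)) - fun z : ℝ × Ω => u z.1 z.2) := by
      abel
    rw [hsplit]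
    refine (eLpNorm_add_le (((avgProcess hv hb hT N).aestronglyMeasurable_value hW).sub hvm)
      (hvm.sub hm) (by norm_num)).trans_lt ?_
    exact (ENNReal.add_lt_add hN hK).trans_eq (ENNReal.add_halves δ)
  -- The tolerance is `1/k`, which is `∞` for `k = 0` and hence always positive.
  choose S hS using fun k : ℕ => key ((k : ℝ≥0∞)⁻¹) (by simp)
  refine ⟨S, (SimpleProcess.tendsto_iff hW S hm).2 ?_⟩
  exact tendsto_of_tendsto_of_tendsto_of_le_of_le tendsto_const_nhds
    ENNReal.tendsto_inv_nat_nhds_zero (fun _ => zero_le) fun k => (hS k).le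

/-- The Itô integral of a control. -/
lemma IsBrownianMotion.mem_itoGraph [IsFiniteMeasure P] {W : ℝ → Ω → E d}
    (hW : IsBrownianMotion P 𝓕 T W) (hT : 0 < T) (hu : u ∈ controls d P 𝓕 T) :
    (fun z => u z.1 z.2, stochIntegral P 𝓕 T W u) ∈ itoGraph P hW := by
  have hm := hu.1.aestronglyMeasurable (P := P) hT.le
  obtain ⟨S, hS⟩ := exists_simpleProcess_tendsto hW hT hu
  obtain ⟨Y, hY⟩ := SimpleProcess.exists_isStochIntegral hW hm hS
  exact (stochIntegral_spec hY).mem_itoGraph hW hm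

lemma memLp_of_mem_controls [IsFiniteMeasure P] (hT : 0 ≤ T) (hu : u ∈ controls d P 𝓕 T) :
    MemLp (fun z : ℝ × Ω => u z.1 z.2) 2 (timeProd P T) := by
  have hm := hu.1.aestronglyMeasurable (P := P) hT
  refine ⟨hm, ?_⟩
  have h := eLpNorm_timeProd_sq hm
  have h2 : eLpNorm (fun z : ℝ × Ω => u z.1 z.2) 2 (timeProd P T) ^ 2 < ∞ := h ▸ hu.2
  exact (ENNReal.pow_lt_top_iff (n := 2)).1 h2 |>.resolve_right (by simp)

lemma IsBrownianMotion.memLp_stochIntegral [IsFiniteMeasure P] {W : ℝ → Ω → E d}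
    (hW : IsBrownianMotion P 𝓕 T W) (hT : 0 < T) (hu : u ∈ controls d P 𝓕 T) :
    MemLp (stochIntegral P 𝓕 T W u) 2 P :=
  memLp_of_mem_itoGraph hW (hW.mem_itoGraph hT hu) (memLp_of_mem_controls hT.le hu)

/-- Linearity of the Itô integral. -/
lemma IsBrownianMotion.stochIntegral_sum [IsFiniteMeasure P] {W : ℝ → Ω → E d}
    (hW : IsBrownianMotion P 𝓕 T W) (hT : 0 < T) {m : ℕ} {v : Fin m → ℝ → Ω → E d}
    (hv : ∀ j, v j ∈ controls d P 𝓕 T) (θ : Fin m → ℝ)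
    (hu : (fun t ω => ∑ j, θ j • v j t ω) ∈ controls d P 𝓕 T) :
    ∀ᵐ ω ∂P, stochIntegral P 𝓕 T W (fun t ω => ∑ j, θ j • v j t ω) ω
      = ∑ j, θ j * stochIntegral P 𝓕 T W (v j) ω := by
  have h1 := hW.mem_itoGraph hT hu
  -- The linear combination of the integrals is in the graph over the same integrand, and integrals
  -- over the same integrand agree almost surely.
  have h2 := Submodule.sum_mem _ fun j (_ : j ∈ Finset.univ) =>
    Submodule.smul_mem _ (θ j) (hW.mem_itoGraph hT (hv j))
  filter_upwards [ae_eq_of_mem_itoGraph hW h1 h2 (ae_of_all _ fun z => by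
    simp [Prod.fst_sum, Finset.sum_apply])] with ω hω
  rw [hω]
  simp [Prod.snd_sum, Finset.sum_apply]

end Density

end CrossEntropy

/-! ### The stochastic integral against the solution -/

namespace CrossEntropy

/-- Along a subsequence the integrals are at most `2⁻ⁿ`; the sum of the functions is then finite
almost everywhere, and its terms tend to zero. -/
lemma exists_seq_ae_tendsto_zero {α : Type*} [MeasurableSpace α] {μ : Measure α}
    {φ : ℕ → α → ℝ≥0∞} (hm : ∀ k, AEMeasurable (φ k) μ)
    (h : Tendsto (fun k => ∫⁻ x, φ k x ∂μ) atTop (𝓝 0)) :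
    ∃ ns : ℕ → ℕ, StrictMono ns ∧ ∀ᵐ x ∂μ, Tendsto (fun k => φ (ns k) x) atTop (𝓝 0) := by
  obtain ⟨ns, hns, hle⟩ := extraction_forall_of_eventually
    (P := fun n k => ∫⁻ x, φ k x ∂μ ≤ (1 / 2 : ℝ≥0∞) ^ n)
    fun n => h.eventually (ge_mem_nhds (ENNReal.pow_pos (by norm_num) n))
  refine ⟨ns, hns, ?_⟩
  have hsum : ∫⁻ x, ∑' k, φ (ns k) x ∂μ ≠ ∞ := by
    rw [lintegral_tsum fun k => hm (ns k)]
    refine ne_top_of_le_ne_top ?_ (ENNReal.tsum_le_tsum hle)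
    rw [ENNReal.tsum_geometric]
    simp
  filter_upwards [ae_lt_top' (AEMeasurable.tsum fun k => hm (ns k)) hsum] with x hx
  exact ENNReal.tendsto_atTop_zero_of_tsum_ne_top hx.ne

lemma memLp_two_of_lintegral {α F : Type*} [MeasurableSpace α] {μ : Measure α}
    [NormedAddCommGroup F] {f : α → F} (hf : AEStronglyMeasurable f μ)
    (h : ∫⁻ x, ‖f x‖ₑ ^ 2 ∂μ < ∞) : MemLp f 2 μ := by
  refine ⟨hf, ?_⟩
  rw [← eLpNorm_two_sq] at h
  exact (ENNReal.pow_lt_top_iff (n := 2)).1 h |>.resolve_right (by simp)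

lemma integrable_inner_of_bound {α F : Type*} [MeasurableSpace α] {μ : Measure α}
    [IsFiniteMeasure μ] [NormedAddCommGroup F] [InnerProductSpace ℝ F] {f β : α → F}
    (hf : MemLp f 2 μ) (hβ : AEStronglyMeasurable β μ) {B : ℝ} (hB : ∀ᵐ x ∂μ, ‖β x‖ ≤ B) :
    Integrable (fun x => inner ℝ (f x) (β x)) μ :=
  integrable_inner_of_memLp hf (MemLp.of_bound hβ B hB)

/-- Against a bounded `β` on a finite measure space, `L²` convergence gives `L¹` convergence of the
products. It is applied to the drift along one path. -/
lemma tendsto_integral_inner {α F : Type*} [MeasurableSpace α] {μ : Measure α}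
    [IsFiniteMeasure μ] [NormedAddCommGroup F] [InnerProductSpace ℝ F] {f : ℕ → α → F}
    {g β : α → F} (hf : ∀ k, MemLp (f k) 2 μ) (hg : MemLp g 2 μ) (hβ : AEStronglyMeasurable β μ)
    {B : ℝ} (hB : ∀ᵐ x ∂μ, ‖β x‖ ≤ B)
    (h : Tendsto (fun k => ∫⁻ x, ‖f k x - g x‖ₑ ^ 2 ∂μ) atTop (𝓝 0)) :
    Tendsto (fun k => ∫ x, inner ℝ (f k x) (β x) ∂μ) atTop
      (𝓝 (∫ x, inner ℝ (g x) (β x) ∂μ)) := by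
  have h2 : Tendsto (fun k => eLpNorm (f k - g) 2 μ) atTop (𝓝 0) := by
    rw [← tendsto_sq_zero_iff]
    simpa only [eLpNorm_two_sq, Pi.sub_apply] using h
  refine tendsto_integral_of_L1' _ (hg.1.inner hβ)
    (Eventually.of_forall fun k => integrable_inner_of_bound (hf k) hβ hB) ?_
  have hC : μ univ ^ (1 / (1 : ℝ≥0∞).toReal - 1 / (2 : ℝ≥0∞).toReal) ≠ ∞ :=
    ENNReal.rpow_ne_top_of_nonneg (by norm_num) (measure_ne_top _ _)
  have hlim := ENNReal.Tendsto.const_mul (a := ENNReal.ofReal B)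
    (ENNReal.Tendsto.mul_const (b := μ univ ^ (1 / (1 : ℝ≥0∞).toReal - 1 / (2 : ℝ≥0∞).toReal))
      h2 (Or.inr hC)) (Or.inr ENNReal.ofReal_ne_top)
  rw [zero_mul, mul_zero] at hlim
  refine tendsto_of_tendsto_of_tendsto_of_le_of_le tendsto_const_nhds hlim
    (fun _ => zero_le) fun k => ?_
  refine (eLpNorm_le_mul_eLpNorm_of_ae_le_mul (g := f k - g) (c := B) ?_ 1).trans ?_
  · filter_upwards [hB] with x hx
    rw [Pi.sub_apply, ← inner_sub_left]
    calc _ ≤ ‖f k x - g x‖ * ‖β x‖ := norm_inner_le_norm _ _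
      _ ≤ ‖f k x - g x‖ * B := by gcongr
      _ = _ := mul_comm _ _
  · gcongr
    exact eLpNorm_le_eLpNorm_mul_rpow_measure_univ (by norm_num) ((hf k).1.sub hg.1)

section Path

variable {Ω : Type*} {mΩ : MeasurableSpace Ω} {P : Measure Ω} {𝓕 : Filtration ℝ mΩ} {d : ℕ}
  {T ε : ℝ} {W X : ℝ → Ω → E d} {b : E d → ℝ → E d} {σ : E d → ℝ → Matrix (Fin d) (Fin d) ℝ}
  {x₀ : E d}

lemma frob_nonneg (A : Matrix (Fin d) (Fin d) ℝ) : 0 ≤ frob A := Real.sqrt_nonneg _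

lemma aestronglyMeasurable_drift (hb : Measurable (fun p : E d × ℝ => b p.1 p.2)) {x : ℝ → E d}
    (hx : ContinuousOn x (Icc 0 T)) :
    AEStronglyMeasurable (fun s => b (x s) s) (volume.restrict (Icc 0 T)) :=
  (hb.comp_aemeasurable ((hx.aemeasurable measurableSet_Icc).prodMk
    aemeasurable_id)).aestronglyMeasurable

/-- A continuous path is bounded on the compact interval, and linear growth carries this to the
drift. The bound depends on the path, which suffices for pathwise limits. -/
lemma exists_drift_bound
    (hgrowth : ∃ C : ℝ, ∀ x, ∀ t ∈ Icc 0 T, ‖b x t‖ + frob (σ x t) ≤ C * (1 + ‖x‖)) {x : ℝ → E d}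
    (hx : ContinuousOn x (Icc 0 T)) : ∃ B : ℝ, ∀ s ∈ Icc 0 T, ‖b (x s) s‖ ≤ B := by
  obtain ⟨C, hC⟩ := hgrowth
  obtain ⟨R, hR⟩ := isCompact_Icc.exists_bound_of_continuousOn hx
  refine ⟨|C| * (1 + R), fun s hs => ?_⟩
  calc ‖b (x s) s‖ ≤ C * (1 + ‖x s‖) := by linarith [hC (x s) s hs, frob_nonneg (σ (x s) s)]
    _ ≤ |C| * (1 + ‖x s‖) := by gcongr; exact le_abs_self C
    _ ≤ |C| * (1 + R) := by gcongr; exact hR s hs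

lemma integrableOn_drift (hb : Measurable (fun p : E d × ℝ => b p.1 p.2))
    (hgrowth : ∃ C : ℝ, ∀ x, ∀ t ∈ Icc 0 T, ‖b x t‖ + frob (σ x t) ≤ C * (1 + ‖x‖)) {x : ℝ → E d}
    (hx : ContinuousOn x (Icc 0 T)) : IntegrableOn (fun s => b (x s) s) (Icc 0 T) := by
  obtain ⟨B, hB⟩ := exists_drift_bound hgrowth hx
  exact Integrable.of_bound (aestronglyMeasurable_drift hb hx) B
    ((ae_restrict_mem measurableSet_Icc).mono fun s hs => hB s hs)

lemma ae_mem_Ioc [SFinite P] (t : ℝ) : ∀ᵐ z ∂(timeProd P t), z.1 ∈ Ioc 0 t := by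
  have h : ∀ᵐ s ∂(volume.restrict (Icc 0 t)), s ∈ Ioc 0 t := by
    rw [← Measure.restrict_congr_set (Ioc_ae_eq_Icc (μ := volume) (a := (0 : ℝ)) (b := t))]
    exact ae_restrict_mem measurableSet_Ioc
  exact Measure.quasiMeasurePreserving_fst.ae h

lemma mem_itoGraph_of_mem_elemSpace [IsFiniteMeasure P] (hW : IsBrownianMotion P 𝓕 T W)
    {p : (ℝ × Ω → E d) × (Ω → ℝ)} (hp : p ∈ elemSpace 𝓕 T W) : p ∈ itoGraph P hW :=
  ⟨(memLp_of_mem_elemSpace hW hp).1.1, (memLp_of_mem_elemSpace hW hp).2.1, fun _ => p,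
    fun _ => hp, by simp, by simp⟩

/-- The simple process with the constant value `c` on `(0, t]`. -/
def constProcess (𝓕 : Filtration ℝ mΩ) {t : ℝ} (ht : 0 ≤ t) (c : E d) :
    SimpleProcess 𝓕 t d where
  n := 1
  τ i := if i = 0 then 0 else t
  ξ _ _ := c
  monotone i j hij := by
    by_cases hi : i = 0 <;> by_cases hj : j = 0 <;> simp [hi, hj, ht]
    omega
  mem i := by by_cases hi : i = 0 <;> simp [hi, ht]
  measurable _ := stronglyMeasurable_const
  bounded _ := ⟨‖c‖, fun _ => le_rfl⟩

/-- The Itô integral of a constant vector. -/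
lemma IsBrownianMotion.stochIntegral_const [IsFiniteMeasure P] (hW : IsBrownianMotion P 𝓕 T W)
    (hT : 0 ≤ T) {c : E d} {H : ℝ → Ω → E d} (hH : ∀ t ∈ Icc 0 T, ∀ ω, H t ω = c) :
    ∀ᵐ ω ∂P, stochIntegral P 𝓕 T W H ω = inner ℝ c (W T ω - W 0 ω) := by
  set S := constProcess (d := d) 𝓕 hT c with hS
  have hval : (fun z : ℝ × Ω => H z.1 z.2) =ᵐ[timeProd P T] fun z => S.value z.1 z.2 := by
    filter_upwards [ae_mem_Ioc T] with z hz
    rw [hH z.1 ⟨hz.1.le, hz.2⟩, S.value_eq (i := 0) (by simp [hS, constProcess])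
      (by simpa [hS, constProcess] using hz)]
    simp [hS, constProcess]
  have hm : AEStronglyMeasurable (fun z : ℝ × Ω => H z.1 z.2) (timeProd P T) :=
    (S.aestronglyMeasurable_value hW).congr hval.symm
  have hlim : Tendsto (fun k : ℕ => ∫⁻ ω, (∫⁻ t in Icc 0 T,
      ‖((fun _ => S) k).value t ω - H t ω‖ₑ ^ 2) ∂P) atTop (𝓝 0) := by
    rw [SimpleProcess.tendsto_iff hW (fun _ => S) hm]
    have h0 : eLpNorm ((fun z : ℝ × Ω => S.value z.1 z.2) - fun z : ℝ × Ω => H z.1 z.2) 2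
        (timeProd P T) = 0 := by
      rw [eLpNorm_congr_ae (g := 0), eLpNorm_zero]
      filter_upwards [hval] with z hz
      simp [hz]
    simp [h0]
  obtain ⟨Y, hY⟩ := SimpleProcess.exists_isStochIntegral hW hm hlim
  have h := ae_eq_of_mem_itoGraph hW ((stochIntegral_spec hY).mem_itoGraph hW hm)
    (mem_itoGraph_of_mem_elemSpace hW (S.mem_elemSpace W)) hval
  filter_upwards [h] with ω hω
  rw [hω]
  simp [hS, constProcess, SimpleProcess.integral]

/-- With unit noise the solution is the Brownian motion plus the integrated drift. -/
lemma IsStrongSolution.eq_of_unit [IsFiniteMeasure P] (hW : IsBrownianMotion P 𝓕 T W)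
    (hX : IsStrongSolution P 𝓕 T ε W b σ x₀ X) (hσ : ∀ x, ∀ t ∈ Icc 0 T, σ x t = 1)
    {t : ℝ} (ht : t ∈ Icc 0 T) :
    ∀ᵐ ω ∂P, X t ω = x₀ + (∫ s in (0 : ℝ)..t, b (X s ω) s) + √ε • (W t ω - W 0 ω) := by
  have h : ∀ᵐ ω ∂P, ∀ i, stochIntegral P 𝓕 t W (rowProcess σ X i) ω
      = inner ℝ (EuclideanSpace.single i 1) (W t ω - W 0 ω) := by
    -- The rows of the identity are the standard basis vectors, so only integrals of constants over
    -- `[0, t]` occur.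
    refine ae_all_iff.2 fun i => (hW.mono ht.2).stochIntegral_const ht.1 fun s hs ω => ?_
    ext j
    simp [rowProcess, hσ (X s ω) s ⟨hs.1, hs.2.trans ht.2⟩, Matrix.one_apply, eq_comm]
  filter_upwards [h, hX.eq t ht] with ω h1 h2
  rw [h2]
  congr 2
  ext i
  simp [h1, EuclideanSpace.inner_single_left]

/-- Over each cell the increment of `X` is the integrated drift plus `c` times the increment of `W`;
`x₀` and `W 0` cancel. The equation is used at the partition points only, because its null set may
depend on the time. -/
lemma SimpleProcess.integral_path (S : SimpleProcess 𝓕 T d) (hT : 0 ≤ T) {ω : Ω} {c : ℝ}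
    {β : ℝ → E d} (hβ : IntegrableOn β (Icc 0 T))
    (hX : ∀ i, X (S.τ i) ω = x₀ + (∫ s in (0 : ℝ)..S.τ i, β s) + c • (W (S.τ i) ω - W 0 ω)) :
    S.integral X ω = (∫ t in Icc 0 T, inner ℝ (S.value t ω) (β t)) + c * S.integral W ω := by
  have hint : ∀ {r s : ℝ}, r ∈ Icc 0 T → s ∈ Icc 0 T → IntervalIntegrable β volume r s :=
    fun hr hs => (intervalIntegrable_iff.2 (hβ.mono_set fun x hx =>
      ⟨(le_min hr.1 hs.1).trans hx.1.le, hx.2.trans (max_le hr.2 hs.2)⟩))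
  have hsub : ∀ i, Ioc (S.τ i) (S.τ (i + 1)) ⊆ Icc 0 T := fun i x hx =>
    ⟨(S.mem i).1.trans hx.1.le, hx.2.trans (S.mem (i + 1)).2⟩
  have hterm : ∀ i, ∀ t, inner ℝ ((Ioc (S.τ i) (S.τ (i + 1))).indicator (fun _ => S.ξ i ω) t) (β t)
      = (Ioc (S.τ i) (S.τ (i + 1))).indicator (fun t => inner ℝ (S.ξ i ω) (β t)) t := fun i t => by
    by_cases h : t ∈ Ioc (S.τ i) (S.τ (i + 1)) <;> simp [h]
  simp only [SimpleProcess.value, sum_inner, hterm]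
  rw [integral_finsetSum]
  · rw [SimpleProcess.integral, SimpleProcess.integral, Finset.mul_sum, ← Finset.sum_add_distrib]
    refine Finset.sum_congr rfl fun i _ => ?_
    rw [setIntegral_indicator measurableSet_Ioc, inter_eq_right.2 (hsub i),
      integral_inner (hβ.mono_set (hsub i)), hX i, hX (i + 1),
      ← intervalIntegral.integral_of_le (S.monotone (Nat.le_succ i)),
      ← intervalIntegral.integral_interval_sub_left (hint ⟨le_rfl, hT⟩ (S.mem (i + 1)))
        (hint ⟨le_rfl, hT⟩ (S.mem i)), ← real_inner_smul_right, ← inner_add_right]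
    congr 1
    module
  · intro i _
    exact (Integrable.const_inner (𝕜 := ℝ) (S.ξ i ω) hβ).indicator measurableSet_Ioc

lemma SimpleProcess.stronglyMeasurable_integral (S : SimpleProcess 𝓕 T d)
    (hX : ∀ t ∈ Icc 0 T, StronglyMeasurable (X t)) : StronglyMeasurable (S.integral X) :=
  Finset.stronglyMeasurable_fun_sum _ fun i _ => ((S.measurable i).mono (𝓕.le _)).inner
    ((hX _ (S.mem (i + 1))).sub (hX _ (S.mem i)))

lemma SimpleProcess.memLp_value (S : SimpleProcess 𝓕 T d) (ω : Ω) :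
    MemLp (fun t => S.value t ω) 2 (volume.restrict (Icc 0 T)) := by
  refine memLp_finsetSum _ fun i _ => ?_
  exact (memLp_const (S.ξ i ω)).indicator measurableSet_Ioc

lemma ae_memLp_path [SFinite P] {u : ℝ → Ω → E d} (hT : 0 ≤ T) (hu : u ∈ controls d P 𝓕 T) :
    ∀ᵐ ω ∂P, MemLp (fun t => u t ω) 2 (volume.restrict (Icc 0 T)) := by
  have hG := hu.1.stronglyMeasurable_extension hT
  have hcongr : ∀ ω, (fun t => (Icc 0 T).indicator (fun s => u s ω) t)
      =ᵐ[volume.restrict (Icc 0 T)] fun t => u t ω := fun ω => by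
    filter_upwards [ae_restrict_mem measurableSet_Icc] with t ht
    rw [indicator_of_mem ht]
  have hlin : ∀ ω, ∫⁻ t in Icc 0 T, ‖(Icc 0 T).indicator (fun s => u s ω) t‖ₑ ^ 2
      = ∫⁻ t in Icc 0 T, ‖u t ω‖ₑ ^ 2 := fun ω =>
    lintegral_congr_ae ((hcongr ω).mono fun t ht => by simp only [ht])
  have hfin := hu.2
  simp only [SqIntegrable, ← hlin] at hfin
  filter_upwards [ae_lt_top (Measurable.lintegral_prod_left' (hG.enorm.pow_const 2)) hfin.ne]
    with ω hω
  exact (memLp_two_of_lintegral (hG.comp_measurable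
    measurable_prodMk_right).aestronglyMeasurable hω).ae_eq (hcongr ω)

section Unit

variable [IsFiniteMeasure P] (hW : IsBrownianMotion P 𝓕 T W) (hT : 0 < T)
  (hb : Measurable (fun p : E d × ℝ => b p.1 p.2))
  (hgrowth : ∃ C : ℝ, ∀ x, ∀ t ∈ Icc 0 T, ‖b x t‖ + frob (σ x t) ≤ C * (1 + ‖x‖))
  (hX : IsStrongSolution P 𝓕 T ε W b σ x₀ X) (hσ : ∀ x, ∀ t ∈ Icc 0 T, σ x t = 1)

include hW hT hb hgrowth hX hσ

/-- Every approximation of a control by simple processes has a subsequence along which the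
elementary integrals against the solution converge almost surely. -/
lemma exists_subseq_integral_tendsto {u : ℝ → Ω → E d} (hu : u ∈ controls d P 𝓕 T)
    {S : ℕ → SimpleProcess 𝓕 T d}
    (hS : Tendsto (fun k => ∫⁻ ω, (∫⁻ t in Icc 0 T, ‖(S k).value t ω - u t ω‖ₑ ^ 2) ∂P)
      atTop (𝓝 0)) :
    ∃ ns : ℕ → ℕ, StrictMono ns ∧ ∀ᵐ ω ∂P, Tendsto (fun k => (S (ns k)).integral X ω) atTop
      (𝓝 ((∫ t in (0 : ℝ)..T, inner ℝ (u t ω) (b (X t ω) t))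
        + √ε * stochIntegral P 𝓕 T W u ω)) := by
  have hm := hu.1.aestronglyMeasurable (P := P) hT.le
  have hmeas : ∀ k, AEMeasurable (fun ω => ∫⁻ t in Icc 0 T, ‖(S k).value t ω - u t ω‖ₑ ^ 2) P :=
    fun k => ((((S k).aestronglyMeasurable_value hW).sub hm).enorm.pow_const 2).lintegral_prod_left'
  -- Two successive subsequences: along the first the simple paths converge in `L²(dt)` for almost
  -- every `ω`, along the second the integrals against `W` converge almost surely.
  obtain ⟨ns, hns, hae⟩ := exists_seq_ae_tendsto_zero hmeas hS
  obtain ⟨Y, hY, hlim⟩ := SimpleProcess.exists_integral_tendsto hW hm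
    (S := fun k => S (ns k)) (hS.comp hns.tendsto_atTop)
  obtain ⟨ms, hms, hae2⟩ := hlim.exists_seq_tendsto_ae
  have hYI := ae_eq_of_mem_itoGraph hW hY (hW.mem_itoGraph hT hu) (ae_eq_refl _)
  -- All partitions together involve countably many times, so one null set is enough.
  have hpath : ∀ᵐ ω ∂P, ∀ k i, X ((S k).τ i) ω
      = x₀ + (∫ s in (0 : ℝ)..(S k).τ i, b (X s ω) s) + √ε • (W ((S k).τ i) ω - W 0 ω) :=
    ae_all_iff.2 fun k => ae_all_iff.2 fun i => hX.eq_of_unit hW hσ ((S k).mem i)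
  refine ⟨ns ∘ ms, hns.comp hms, ?_⟩
  filter_upwards [hae, hae2, hYI, hpath, ae_memLp_path hT.le hu] with ω h1 h2 h3 h4 h5
  have hc := hX.continuous ω
  obtain ⟨B, hB⟩ := exists_drift_bound hgrowth hc
  have h6 := tendsto_integral_inner (fun k => (S (ns (ms k))).memLp_value ω) h5
    (aestronglyMeasurable_drift hb hc) ((ae_restrict_mem measurableSet_Icc).mono hB)
    (h1.comp hms.tendsto_atTop)
  rw [intervalIntegral.integral_of_le hT.le, ← integral_Icc_eq_integral_Ioc]
  simp only [Function.comp_apply,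
    fun k => (S k).integral_path hT.le (integrableOn_drift hb hgrowth hc) (h4 k)]
  rw [← h3]
  exact h6.add (h2.const_mul _)

/-- The stochastic integral against the solution of the equation with unit noise. -/
lemma stochIntegral_solution {u : ℝ → Ω → E d} (hu : u ∈ controls d P 𝓕 T) :
    ∀ᵐ ω ∂P, stochIntegral P 𝓕 T X u ω
      = (∫ t in (0 : ℝ)..T, inner ℝ (u t ω) (b (X t ω) t)) + √ε * stochIntegral P 𝓕 T W u ω := by
  -- Existence comes first: without it `stochIntegral` would be the default value `0`.
  have hex : ∃ Y, IsStochIntegral P 𝓕 T X u Y := by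
    obtain ⟨S, hS⟩ := exists_simpleProcess_tendsto hW hT hu
    obtain ⟨ns, hns, hae⟩ := exists_subseq_integral_tendsto hW hT hb hgrowth hX hσ hu hS
    have hm : ∀ k, AEStronglyMeasurable ((S (ns k)).integral X) P := fun k =>
      ((S (ns k)).stronglyMeasurable_integral fun t ht =>
        (hX.adapted t ht).mono (𝓕.le t)).aestronglyMeasurable
    have hlim := aestronglyMeasurable_of_tendsto_ae _ hm hae
    exact ⟨hlim.mk _, hlim.stronglyMeasurable_mk, fun k => S (ns k), hS.comp hns.tendsto_atTop,
      (tendstoInMeasure_of_tendsto_ae hm hae).congr_right hlim.ae_eq_mk⟩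
  obtain ⟨Y, hY⟩ := hex
  -- The chosen version comes with an approximation of its own. Along a common subsequence its
  -- elementary integrals converge both to it and to the claimed value.
  obtain ⟨-, S, hS, hlim⟩ := stochIntegral_spec hY
  obtain ⟨ns, hns, hae⟩ := hlim.exists_seq_tendsto_ae
  obtain ⟨ms, hms, hae2⟩ := exists_subseq_integral_tendsto hW hT hb hgrowth hX hσ hu
    (S := fun k => S (ns k)) (hS.comp hns.tendsto_atTop)
  filter_upwards [hae, hae2] with ω h1 h2
  exact tendsto_nhds_unique (h1.comp hms.tendsto_atTop) h2

end Unit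

end Path

end CrossEntropy

namespace CrossEntropy

/-! ### Divergence of measures with positive densities -/

section WithDensity

variable {α : Type*} {mα : MeasurableSpace α} {μ : Measure α} {f h F : α → ℝ}

lemma integrable_withDensity_ofReal (hf : AEMeasurable f μ) (h0 : ∀ x, 0 ≤ f x) :
    Integrable F (μ.withDensity fun x => ENNReal.ofReal (f x))
      ↔ Integrable (fun x => f x * F x) μ := by
  rw [integrable_withDensity_iff_integrable_smul₀' hf.ennreal_ofReal (by simp)]
  simp [ENNReal.toReal_ofReal, h0]

lemma integral_withDensity_ofReal (hf : AEMeasurable f μ) (h0 : ∀ x, 0 ≤ f x) :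
    ∫ x, F x ∂(μ.withDensity fun x => ENNReal.ofReal (f x)) = ∫ x, f x * F x ∂μ := by
  rw [integral_withDensity_eq_integral_toReal_smul₀ hf.ennreal_ofReal (by simp)]
  simp [ENNReal.toReal_ofReal, h0]

lemma withDensity_ofReal_absolutelyContinuous (hh : AEMeasurable h μ) (h0 : ∀ x, 0 < h x) :
    μ.withDensity (fun x => ENNReal.ofReal (f x))
      ≪ μ.withDensity (fun x => ENNReal.ofReal (h x)) :=
  (withDensity_absolutelyContinuous _ _).trans
    (withDensity_absolutelyContinuous' hh.ennreal_ofReal (by simp [h0]))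

/-- The log-likelihood ratio of two measures with positive densities. -/
lemma llr_withDensity_ofReal [SigmaFinite μ] (hf : AEMeasurable f μ) (f0 : ∀ x, 0 < f x)
    (hh : AEMeasurable h μ) (h0 : ∀ x, 0 < h x) :
    llr (μ.withDensity fun x => ENNReal.ofReal (f x)) (μ.withDensity fun x => ENNReal.ofReal (h x))
      =ᵐ[μ] fun x => Real.log (f x) - Real.log (h x) := by
  have h1 := Measure.rnDeriv_withDensity_right
    (μ.withDensity fun x => ENNReal.ofReal (f x)) μ hh.ennreal_ofReal (by simp [h0]) (by simp)
  have h2 := Measure.rnDeriv_withDensity_left (μ := μ) (ν := μ) hf.ennreal_ofReal (by simp)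
  filter_upwards [h1, h2, Measure.rnDeriv_self μ] with x h1 h2 h3
  rw [llr, h1, h2, h3, mul_one, ← ENNReal.ofReal_inv_of_pos (h0 x),
    ← ENNReal.ofReal_mul (inv_nonneg.2 (h0 x).le),
    ENNReal.toReal_ofReal (mul_nonneg (inv_nonneg.2 (h0 x).le) (f0 x).le),
    Real.log_mul (inv_ne_zero (h0 x).ne') (f0 x).ne', Real.log_inv]
  ring

lemma klIntegral_withDensity_ofReal [SigmaFinite μ] (hf : AEMeasurable f μ) (f0 : ∀ x, 0 < f x)
    (hh : AEMeasurable h μ) (h0 : ∀ x, 0 < h x)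
    (hff : Integrable (fun x => f x * Real.log (f x)) μ)
    (hfh : Integrable (fun x => f x * Real.log (h x)) μ) :
    Integrable (llr (μ.withDensity fun x => ENNReal.ofReal (f x))
        (μ.withDensity fun x => ENNReal.ofReal (h x)))
        (μ.withDensity fun x => ENNReal.ofReal (f x)) ∧
      klIntegral (μ.withDensity fun x => ENNReal.ofReal (f x))
          (μ.withDensity fun x => ENNReal.ofReal (h x))
        = (∫ x, f x * Real.log (f x) ∂μ) - ∫ x, f x * Real.log (h x) ∂μ := by
  have hae : (fun x => f x * llr (μ.withDensity fun x => ENNReal.ofReal (f x))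
      (μ.withDensity fun x => ENNReal.ofReal (h x)) x)
      =ᵐ[μ] fun x => f x * Real.log (f x) - f x * Real.log (h x) := by
    filter_upwards [llr_withDensity_ofReal hf f0 hh h0] with x hx
    rw [hx, mul_sub]
  refine ⟨?_, ?_⟩
  · rw [integrable_withDensity_ofReal hf fun x => (f0 x).le]
    exact (hff.sub hfh).congr hae.symm
  · rw [klIntegral, integral_withDensity_ofReal hf fun x => (f0 x).le, integral_congr_ae hae,
      integral_sub hff hfh]

/-- For equal masses the correction term in `klDiv` cancels. Nonnegativity is kept because
`ENNReal.ofReal` reflects the order only there. -/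
lemma klDiv_eq_ofReal_klIntegral {ν ρ : Measure α} [IsProbabilityMeasure ν]
    [IsProbabilityMeasure ρ] (hac : ν ≪ ρ) (hi : Integrable (llr ν ρ) ν) :
    0 ≤ klIntegral ν ρ ∧ klDiv ν ρ = ENNReal.ofReal (klIntegral ν ρ) := by
  have h := integral_llr_add_sub_measure_univ_nonneg hac hi
  rw [klDiv_of_ac_of_integrable hac hi]
  simpa [klIntegral] using h

lemma isMinOn_iff_isMaxOn_of_eq_sub {β : Type*} {F G : β → ℝ} {c : ℝ} {s : Set β} {a : β}
    (ha : a ∈ s) (h : ∀ v ∈ s, F v = c - G v) : IsMinOn F s a ↔ IsMaxOn G s a := by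
  simp only [isMinOn_iff, isMaxOn_iff]
  refine forall₂_congr fun v hv => ?_
  rw [h v hv, h a ha, sub_le_sub_iff_left]

end WithDensity

/-! ### The optimal density, the Girsanov densities and their divergence -/

section Densities

variable {Ω : Type*} {mΩ : MeasurableSpace Ω} {P : Measure Ω}
  {𝓕 : Filtration ℝ mΩ} {d : ℕ} {T ε : ℝ} {W X : ℝ → Ω → E d} {u : ℝ → Ω → E d}
  (g : E d →ᵇ ℝ)

lemma neg_div_mem (hε : 0 < ε) (x : E d) : -(‖g‖ / ε) ≤ -g x / ε ∧ -g x / ε ≤ ‖g‖ / ε := by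
  have h := abs_le.1 (g.norm_coe_le_norm x)
  rw [neg_div, neg_le_neg_iff, ← neg_div]
  constructor <;> gcongr <;> linarith

lemma exp_bounds (hε : 0 < ε) (ω : Ω) : Real.exp (-(‖g‖ / ε)) ≤ Real.exp (-g (X T ω) / ε) ∧
    Real.exp (-g (X T ω) / ε) ≤ Real.exp (‖g‖ / ε) :=
  ⟨Real.exp_le_exp.2 (neg_div_mem g hε _).1, Real.exp_le_exp.2 (neg_div_mem g hε _).2⟩

lemma measurable_exp_terminal (hX : Measurable (X T)) :
    Measurable fun ω => Real.exp (-g (X T ω) / ε) := by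
  have := g.continuous.measurable.comp hX
  simp only [Function.comp_def] at this
  fun_prop

lemma measurable_optDensity (hX : Measurable (X T)) : Measurable (optDensity P T ε X g) :=
  (measurable_exp_terminal g hX).div_const _

lemma girsanovDensity_pos (ω : Ω) : 0 < girsanovDensity P 𝓕 T ε W u ω := Real.exp_pos _

variable [IsProbabilityMeasure P]

lemma integrable_exp_terminal (hε : 0 < ε) (hX : Measurable (X T)) :
    Integrable (fun ω => Real.exp (-g (X T ω) / ε)) P :=
  Integrable.of_bound (measurable_exp_terminal g hX).aestronglyMeasurable (Real.exp (‖g‖ / ε))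
    (ae_of_all _ fun ω => by
      rw [Real.norm_of_nonneg (Real.exp_pos _).le]
      exact (exp_bounds g hε ω).2)

lemma rho_pos (hε : 0 < ε) (hX : Measurable (X T)) : 0 < rho P T ε X g := by
  refine (Real.exp_pos (-(‖g‖ / ε))).trans_le ?_
  have h := integral_mono (μ := P) (integrable_const (Real.exp (-(‖g‖ / ε))))
    (integrable_exp_terminal g hε hX) fun ω => (exp_bounds g hε ω).1
  rw [integral_const] at h
  simpa [rho] using h

lemma optDensity_pos (hε : 0 < ε) (hX : Measurable (X T)) (ω : Ω) : 0 < optDensity P T ε X g ω :=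
  div_pos (Real.exp_pos _) (rho_pos g hε hX)

lemma optDensity_le (hε : 0 < ε) (hX : Measurable (X T)) (ω : Ω) :
    optDensity P T ε X g ω ≤ Real.exp (‖g‖ / ε) / rho P T ε X g :=
  div_le_div_of_nonneg_right (exp_bounds g hε ω).2 (rho_pos g hε hX).le

/-- Boundedness of `g` bounds `L*`, so weighting by `L*` preserves integrability under `P`. -/
lemma integrable_optDensity_mul (hε : 0 < ε) (hX : Measurable (X T)) {F : Ω → ℝ}
    (hF : Integrable F P) : Integrable (fun ω => optDensity P T ε X g ω * F ω) P :=
  hF.bdd_mul (c := Real.exp (‖g‖ / ε) / rho P T ε X g)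
    (measurable_optDensity g hX).aestronglyMeasurable (ae_of_all _ fun ω => by
      rw [Real.norm_of_nonneg (optDensity_pos g hε hX ω).le]
      exact optDensity_le g hε hX ω)

lemma integrable_log_optDensity (hε : 0 < ε) (hX : Measurable (X T)) :
    Integrable (fun ω => Real.log (optDensity P T ε X g ω)) P := by
  have h : (fun ω => Real.log (optDensity P T ε X g ω))
      = fun ω => -g (X T ω) / ε - Real.log (rho P T ε X g) := by
    ext ω
    rw [optDensity, Real.log_div (Real.exp_ne_zero _) (rho_pos g hε hX).ne', Real.log_exp]
  rw [h]
  have hm := g.continuous.measurable.comp hX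
  refine Integrable.sub (Integrable.of_bound (C := ‖g‖ / ε)
    (hm.neg.div_const ε).aestronglyMeasurable (ae_of_all _ fun ω => ?_)) (integrable_const _)
  exact abs_le.2 (neg_div_mem g hε _)

lemma isProbabilityMeasure_optMeasure (hε : 0 < ε) (hX : Measurable (X T)) :
    IsProbabilityMeasure (optMeasure P T ε X g) := by
  refine ⟨?_⟩
  have hi : Integrable (optDensity P T ε X g) P :=
    (integrable_exp_terminal (P := P) g hε hX).div_const _
  rw [optMeasure, withDensity_apply _ MeasurableSet.univ, Measure.restrict_univ,
    ← ofReal_integral_eq_lintegral_ofReal hi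
      (ae_of_all _ fun ω => (optDensity_pos g hε hX ω).le)]
  have h : ∫ ω, optDensity P T ε X g ω ∂P = 1 := by
    simp only [optDensity]
    rw [integral_div]
    exact div_self (rho_pos g hε hX).ne'
  rw [h, ENNReal.ofReal_one]

lemma intervalIntegral_eq_Icc (hT : 0 ≤ T) (f : ℝ → ℝ) :
    ∫ t in (0 : ℝ)..T, f t = ∫ t in Icc 0 T, f t := by
  rw [intervalIntegral.integral_of_le hT, integral_Icc_eq_integral_Ioc]

lemma integrable_energy (hT : 0 ≤ T) (hu : u ∈ controls d P 𝓕 T) :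
    Integrable (fun ω => ∫ s in (0 : ℝ)..T, ‖u s ω‖ ^ 2) P := by
  simp only [intervalIntegral_eq_Icc hT]
  exact (memLp_of_mem_controls hT hu).integrable_norm_pow (by simp) |>.integral_prod_right

/-- Only the logarithm is integrated: an `L²` Itô integral and the energy. Nothing is needed about
the expectation of the density itself. -/
lemma integrable_log_girsanovDensity (hW : IsBrownianMotion P 𝓕 T W) (hT : 0 < T)
    (hu : u ∈ controls d P 𝓕 T) :
    Integrable (fun ω => Real.log (girsanovDensity P 𝓕 T ε W u ω)) P := by
  simp only [girsanovDensity, Real.log_exp]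
  exact (((hW.memLp_stochIntegral hT hu).integrable (by norm_num)).const_mul _).sub
    ((integrable_energy hT.le hu).const_mul _)

lemma aemeasurable_girsanovDensity (hT : 0 ≤ T) (hu : u ∈ controls d P 𝓕 T) :
    AEMeasurable (girsanovDensity P 𝓕 T ε W u) P := by
  have h1 := (stronglyMeasurable_stochIntegral (P := P) (𝓕 := 𝓕) (T := T) (Z := W)
    (H := u)).measurable.aemeasurable (μ := P)
  have h2 := (integrable_energy hT hu).1.aemeasurable
  exact Real.measurable_exp.comp_aemeasurable ((h1.const_mul _).sub (h2.const_mul _))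

/-- The Kullback-Leibler divergence of a controlled measure from the optimal one. -/
lemma klIntegral_controlMeasure (hW : IsBrownianMotion P 𝓕 T W) (hT : 0 < T) (hε : 0 < ε)
    (hX : Measurable (X T)) (hu : u ∈ controls d P 𝓕 T) :
    Integrable (fun ω => optDensity P T ε X g ω
        * Real.log (girsanovDensity P 𝓕 T ε W u ω)) P ∧
      optMeasure P T ε X g ≪ controlMeasure P 𝓕 T ε W u ∧
      Integrable (llr (optMeasure P T ε X g) (controlMeasure P 𝓕 T ε W u))
        (optMeasure P T ε X g) ∧
      klIntegral (optMeasure P T ε X g) (controlMeasure P 𝓕 T ε W u)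
        = (∫ ω, optDensity P T ε X g ω * Real.log (optDensity P T ε X g ω) ∂P)
          - ceObjective P 𝓕 T ε W X g u := by
  have h1 := integrable_optDensity_mul (P := P) g hε hX
    (integrable_log_girsanovDensity (ε := ε) hW hT hu)
  have h2 := klIntegral_withDensity_ofReal (measurable_optDensity (P := P) (ε := ε) g hX).aemeasurable
    (optDensity_pos g hε hX) (aemeasurable_girsanovDensity (ε := ε) (W := W) hT.le hu)
    girsanovDensity_pos
    (integrable_optDensity_mul g hε hX (integrable_log_optDensity g hε hX)) h1
  exact ⟨h1, withDensity_ofReal_absolutelyContinuous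
    (aemeasurable_girsanovDensity hT.le hu) girsanovDensity_pos, h2⟩

/-- The density of the proposal is positive and cancels the denominator of the weight pointwise, so
its total mass is irrelevant. -/
lemma integral_weight_mul {m : ℕ} {ψ : Fin m → E d → ℝ → E d} {θk : Fin m → ℝ} (hT : 0 < T)
    (hk : linControl X ψ θk ∈ controls d P 𝓕 T) {F : Ω → ℝ}
    (hF : Integrable (fun ω => optDensity P T ε X g ω * F ω) P) :
    Integrable (fun ω => weight P 𝓕 T ε W X g ψ θk ω * F ω)
        (controlMeasure P 𝓕 T ε W (linControl X ψ θk)) ∧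
      ∫ ω, weight P 𝓕 T ε W X g ψ θk ω * F ω ∂(controlMeasure P 𝓕 T ε W (linControl X ψ θk))
        = ∫ ω, optDensity P T ε X g ω * F ω ∂P := by
  have hm := aemeasurable_girsanovDensity (ε := ε) (W := W) hT.le hk
  have h0 : ∀ ω, 0 ≤ girsanovDensity P 𝓕 T ε W (linControl X ψ θk) ω := fun ω =>
    (girsanovDensity_pos ω).le
  have heq : ∀ ω, girsanovDensity P 𝓕 T ε W (linControl X ψ θk) ω
      * (weight P 𝓕 T ε W X g ψ θk ω * F ω) = optDensity P T ε X g ω * F ω := fun ω => by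
    rw [weight, ← mul_assoc, mul_div_cancel₀ _ (girsanovDensity_pos ω).ne']
  constructor
  · rw [controlMeasure, integrable_withDensity_ofReal hm h0]
    simpa only [heq] using hF
  · rw [controlMeasure, integral_withDensity_ofReal hm h0]
    simp only [heq]

end Densities

/-! ### Linearity of the gradient -/

section Gradient

lemma gradient_sum_mul {F : Type*} [NormedAddCommGroup F] [InnerProductSpace ℝ F] [CompleteSpace F]
    {ι : Type*} (s : Finset ι) {φ : ι → F → ℝ} {x : F} (h : ∀ j ∈ s, DifferentiableAt ℝ (φ j) x)
    (θ : ι → ℝ) :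
    gradient (fun y => ∑ j ∈ s, θ j * φ j y) x = ∑ j ∈ s, θ j • gradient (φ j) x := by
  simp only [gradient]
  rw [fderiv_fun_sum fun j hj => (h j hj).const_mul (θ j), map_sum]
  refine Finset.sum_congr rfl fun j hj => ?_
  rw [fderiv_const_mul (h j hj), map_smulₛₗ]
  simp

end Gradient

end CrossEntropy

namespace CrossEntropy

/-! ### Concave quadratic functions and normal equations -/

section Quadratic

variable {ι : Type*} [Fintype ι]

/-- The quadratic function `θ ↦ c (r · θ) - (c / 2) (θ · A θ)`. -/
noncomputable def quadFun (c : ℝ) (A : Matrix ι ι ℝ) (r θ : ι → ℝ) : ℝ :=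
  c * (r ⬝ᵥ θ) - c / 2 * (θ ⬝ᵥ A.mulVec θ)

lemma continuous_quadFun (c : ℝ) (A : Matrix ι ι ℝ) (r : ι → ℝ) : Continuous (quadFun c A r) := by
  unfold quadFun dotProduct Matrix.mulVec dotProduct
  fun_prop

lemma sum_mul_quadFun {N : ℕ} (c : ℝ) (w : Fin N → ℝ) (A : Fin N → Matrix ι ι ℝ)
    (r : Fin N → ι → ℝ) (θ : ι → ℝ) :
    ∑ i, w i * quadFun c (A i) (r i) θ = quadFun c (∑ i, w i • A i) (∑ i, w i • r i) θ := by
  simp only [quadFun, sum_dotProduct, Matrix.sum_mulVec, dotProduct_sum, smul_dotProduct,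
    Matrix.smul_mulVec, dotProduct_smul, smul_eq_mul, Finset.mul_sum, ← Finset.sum_sub_distrib]
  exact Finset.sum_congr rfl fun i _ => by ring

/-- The linear part drops out, and the gap between the two sides of the concavity inequality is
exactly `(c / 2) a b` times the form at `x - y`. -/
lemma concaveOn_quadFun {c : ℝ} (hc : 0 ≤ c) {A : Matrix ι ι ℝ}
    (hA : ∀ v, 0 ≤ v ⬝ᵥ A.mulVec v) (r : ι → ℝ) : ConcaveOn ℝ univ (quadFun c A r) := by
  refine ⟨convex_univ, fun x _ y _ a b ha hb hab => ?_⟩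
  have h : quadFun c A r (a • x + b • y) - (a * quadFun c A r x + b * quadFun c A r y)
      = c / 2 * (a * b) * ((x - y) ⬝ᵥ A.mulVec (x - y)) := by
    obtain rfl : b = 1 - a := by linarith
    simp only [quadFun, Matrix.mulVec_add, Matrix.mulVec_sub, Matrix.mulVec_smul, dotProduct_add,
      add_dotProduct, dotProduct_sub, sub_dotProduct, smul_dotProduct, dotProduct_smul, smul_eq_mul]
    ring
  have h2 : 0 ≤ c / 2 * (a * b) * ((x - y) ⬝ᵥ A.mulVec (x - y)) :=
    mul_nonneg (by positivity) (hA _)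
  simp only [smul_eq_mul]
  linarith

/-- The exact second-order expansion, with gradient `c (r - A θ)`. Symmetry of `A` merges the two
cross terms. -/
lemma quadFun_add {c : ℝ} {A : Matrix ι ι ℝ} (hA : A.transpose = A) (r θ h : ι → ℝ) :
    quadFun c A r (θ + h)
      = quadFun c A r θ + c * ((r - A.mulVec θ) ⬝ᵥ h) - c / 2 * (h ⬝ᵥ A.mulVec h) := by
  have hs : θ ⬝ᵥ A.mulVec h = A.mulVec θ ⬝ᵥ h := by
    rw [Matrix.dotProduct_mulVec, ← Matrix.mulVec_transpose, hA]
  simp only [quadFun, Matrix.mulVec_add, dotProduct_add, add_dotProduct, sub_dotProduct, hs,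
    dotProduct_comm h (A.mulVec θ)]
  ring

/-- An interior point maximizes a concave quadratic function exactly if it solves the normal
equations. -/
lemma isMaxOn_quadFun_iff {c : ℝ} (hc : 0 < c) {A : Matrix ι ι ℝ} (hA : A.transpose = A)
    (hA0 : ∀ v, 0 ≤ v ⬝ᵥ A.mulVec v) {r θ : ι → ℝ} {Θ : Set (ι → ℝ)} (hθ : θ ∈ interior Θ) :
    IsMaxOn (quadFun c A r) Θ θ ↔ A.mulVec θ = r := by
  constructor
  · intro hmax
    -- Move a small step `s > 0` in the gradient direction `v`, which stays in `Θ`. Maximality gives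
    -- `v · v ≤ s (v · A v) / 2`, and `s → 0` forces `v = 0`.
    set v := r - A.mulVec θ with hv
    have hev : ∀ᶠ s : ℝ in 𝓝[>] 0, θ + s • v ∈ Θ := by
      have hc : Tendsto (fun s : ℝ => θ + s • v) (𝓝[>] 0) (𝓝 θ) := by
        have : Continuous fun s : ℝ => θ + s • v := by fun_prop
        simpa using (this.tendsto 0).mono_left nhdsWithin_le_nhds
      exact hc.eventually (mem_interior_iff_mem_nhds.1 hθ)
    have hle : ∀ᶠ s : ℝ in 𝓝[>] 0, v ⬝ᵥ v ≤ s * ((v ⬝ᵥ A.mulVec v) / 2) := by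
      filter_upwards [hev, self_mem_nhdsWithin] with s hs hs0
      have h := isMaxOn_iff.1 hmax _ hs
      rw [quadFun_add hA, ← hv] at h
      simp only [Matrix.mulVec_smul, dotProduct_smul, smul_dotProduct, smul_eq_mul] at h
      have hs0' : 0 < s := hs0
      have h2 : c * s * (v ⬝ᵥ v) ≤ c * s * (s * ((v ⬝ᵥ A.mulVec v) / 2)) := by linarith
      exact le_of_mul_le_mul_left h2 (mul_pos hc hs0')
    have hlim : Tendsto (fun s : ℝ => s * ((v ⬝ᵥ A.mulVec v) / 2)) (𝓝[>] 0) (𝓝 0) := by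
      have : Continuous fun s : ℝ => s * ((v ⬝ᵥ A.mulVec v) / 2) := by fun_prop
      simpa using (this.tendsto 0).mono_left nhdsWithin_le_nhds
    have hv0 : v ⬝ᵥ v ≤ 0 := ge_of_tendsto hlim hle
    have hvz : v = 0 := dotProduct_self_eq_zero.1
      (le_antisymm hv0 (Finset.sum_nonneg fun i _ => mul_self_nonneg _))
    exact (sub_eq_zero.1 hvz).symm
  · intro h
    -- At a solution the first-order term is gone and the second-order term has a sign everywhere,
    -- so the maximum is global.
    refine isMaxOn_iff.2 fun η _ => ?_
    have h1 := quadFun_add (c := c) hA r θ (η - θ)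
    rw [add_sub_cancel, h, sub_self, zero_dotProduct, mul_zero, add_zero] at h1
    have h2 := mul_nonneg (half_pos hc).le (hA0 (η - θ))
    linarith

end Quadratic

/-! ### Linear controls: Gram matrices and the log-likelihood -/

section LinearControls

variable {Ω : Type*} {mΩ : MeasurableSpace Ω} {P : Measure Ω} {𝓕 : Filtration ℝ mΩ} {d m : ℕ}
  {T ε : ℝ} {W X : ℝ → Ω → E d} {b : E d → ℝ → E d} {σ : E d → ℝ → Matrix (Fin d) (Fin d) ℝ}
  {x₀ : E d} {ψ : Fin m → E d → ℝ → E d}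

/-- A continuous adapted process is progressive, and a Borel function of the state and time
preserves this. -/
lemma IsStrongSolution.progressiveOn_comp (hX : IsStrongSolution P 𝓕 T ε W b σ x₀ X)
    {f : E d → ℝ → E d} (hf : Measurable (fun p : E d × ℝ => f p.1 p.2)) :
    ProgressiveOn 𝓕 T fun t ω => f (X t ω) t := fun t ht => by
  let _ : MeasurableSpace Ω := 𝓕 t
  have h1 : StronglyMeasurable (Function.uncurry fun (s : Icc (0 : ℝ) t) ω => X s ω) :=
    stronglyMeasurable_uncurry_of_continuous_of_stronglyMeasurable
      (fun ω => (continuousOn_iff_continuous_domRestrict.1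
        ((hX.continuous ω).mono (Icc_subset_Icc_right ht.2))))
      fun s => (hX.adapted s ⟨s.2.1, s.2.2.trans ht.2⟩).mono (𝓕.mono s.2.2)
  exact (hf.comp (h1.measurable.prodMk
    (measurable_subtype_coe.comp measurable_fst))).stronglyMeasurable

lemma ProgressiveOn.linearCombination {v : Fin m → ℝ → Ω → E d}
    (hv : ∀ j, ProgressiveOn 𝓕 T (v j)) (θ : Fin m → ℝ) :
    ProgressiveOn 𝓕 T fun t ω => ∑ j, θ j • v j t ω := fun t ht =>
  Finset.stronglyMeasurable_fun_sum _ fun j _ => (hv j t ht).fun_const_smul (θ j)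

lemma linearCombination_mem_controls [IsFiniteMeasure P] (hT : 0 ≤ T) {v : Fin m → ℝ → Ω → E d}
    (hv : ∀ j, v j ∈ controls d P 𝓕 T) (θ : Fin m → ℝ) :
    (fun t ω => ∑ j, θ j • v j t ω) ∈ controls d P 𝓕 T := by
  have hp := ProgressiveOn.linearCombination (fun j => (hv j).1) θ
  refine ⟨hp, ?_⟩
  have h : MemLp (fun z : ℝ × Ω => ∑ j, θ j • v j z.1 z.2) 2 (timeProd P T) :=
    memLp_finsetSum _ fun j _ => (memLp_of_mem_controls hT (hv j)).const_smul (θ j)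
  rw [SqIntegrable, ← eLpNorm_timeProd_sq (H := fun z : ℝ × Ω => ∑ j, θ j • v j z.1 z.2) h.1]
  exact ENNReal.pow_lt_top h.2

/-- The energy of a linear control is the quadratic form of the Gram matrix. -/
lemma energy_linControl (hT : 0 ≤ T) {ω : Ω}
    (h : ∀ j, MemLp (fun t => ψ j (X t ω) t) 2 (volume.restrict (Icc 0 T))) (θ : Fin m → ℝ) :
    ∫ t in (0 : ℝ)..T, ‖linControl X ψ θ t ω‖ ^ 2 = ∑ j, ∑ l, θ j * θ l * gram T X ψ j l ω := by
  have hi : ∀ j l, Integrable (fun t => θ j * (θ l * inner ℝ (ψ l (X t ω) t) (ψ j (X t ω) t)))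
      (volume.restrict (Icc 0 T)) := fun j l =>
    ((integrable_inner_of_memLp (h l) (h j)).const_mul _).const_mul _
  simp only [gram, intervalIntegral_eq_Icc hT, ← real_inner_self_eq_norm_sq, linControl, sum_inner,
    inner_sum, real_inner_smul_left, real_inner_smul_right]
  rw [integral_finsetSum _ fun j _ => integrable_finsetSum _ fun l _ => hi j l]
  refine Finset.sum_congr rfl fun j _ => ?_
  rw [integral_finsetSum _ fun l _ => hi j l]
  refine Finset.sum_congr rfl fun l _ => ?_
  simp only [integral_const_mul, mul_assoc, real_inner_comm]

/-- The Gram matrix of a path. -/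
noncomputable def gramMatrix (T : ℝ) (X : ℝ → Ω → E d) (ψ : Fin m → E d → ℝ → E d) (ω : Ω) :
    Matrix (Fin m) (Fin m) ℝ :=
  Matrix.of fun j l => gram T X ψ j l ω

lemma gramMatrix_transpose (ω : Ω) : (gramMatrix T X ψ ω).transpose = gramMatrix T X ψ ω := by
  ext j l
  simp only [gramMatrix, gram, Matrix.transpose_apply, Matrix.of_apply, real_inner_comm]

lemma dotProduct_gramMatrix (ω : Ω) (θ : Fin m → ℝ) :
    θ ⬝ᵥ (gramMatrix T X ψ ω).mulVec θ = ∑ j, ∑ l, θ j * θ l * gram T X ψ j l ω := by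
  simp only [dotProduct, Matrix.mulVec, gramMatrix, Matrix.of_apply, Finset.mul_sum]
  exact Finset.sum_congr rfl fun j _ => Finset.sum_congr rfl fun l _ => by ring

/-- The form of the Gram matrix is the energy of a control. Square integrability along the path
justifies expanding the energy. -/
lemma dotProduct_gramMatrix_nonneg (hT : 0 ≤ T) {ω : Ω}
    (h : ∀ j, MemLp (fun t => ψ j (X t ω) t) 2 (volume.restrict (Icc 0 T))) (θ : Fin m → ℝ) :
    0 ≤ θ ⬝ᵥ (gramMatrix T X ψ ω).mulVec θ := by
  rw [dotProduct_gramMatrix, ← energy_linControl hT h]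
  exact intervalIntegral.integral_nonneg hT fun t _ => sq_nonneg _

lemma quadForm_eq_quadFun (θ : Fin m → ℝ) (ω : Ω) :
    quadForm P 𝓕 T ε b X ψ θ ω = quadFun (1 / ε) (gramMatrix T X ψ ω)
      (fun j => driftIntegral T b X ψ j ω - pathIntegral P 𝓕 T X ψ j ω) θ := by
  rw [quadForm, quadFun, dotProduct_gramMatrix, dotProduct, div_div, mul_comm ε 2, neg_mul,
    ← mul_neg, ← Finset.sum_neg_distrib]
  congr 2
  exact Finset.sum_congr rfl fun j _ => by ring

lemma normalMatrix_eq {N : ℕ} (w : Fin N → ℝ) (x : Fin N → Ω) :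
    normalMatrix T X ψ w x = ∑ i, w i • gramMatrix T X ψ (x i) := by
  ext j l
  simp [normalMatrix, gramMatrix, Matrix.sum_apply]

lemma normalVector_eq {N : ℕ} (w : Fin N → ℝ) (x : Fin N → Ω) :
    normalVector P 𝓕 T b X ψ w x = ∑ i, w i • fun j =>
      driftIntegral T b X ψ j (x i) - pathIntegral P 𝓕 T X ψ j (x i) := by
  ext j
  simp [normalVector, Finset.sum_apply]

/-- The normal equations of the weighted log-likelihood. -/
lemma isMaxOn_weighted_iff (hT : 0 ≤ T) (hε : 0 < ε) {N : ℕ} {w : Fin N → ℝ} (hw : ∀ i, 0 ≤ w i)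
    {x : Fin N → Ω} {ℓ : (Fin m → ℝ) → Ω → ℝ}
    (hℓ : ∀ i θ, ℓ θ (x i) = quadForm P 𝓕 T ε b X ψ θ (x i))
    (h : ∀ i j, MemLp (fun t => ψ j (X t (x i)) t) 2 (volume.restrict (Icc 0 T)))
    {θ : Fin m → ℝ} {Θ : Set (Fin m → ℝ)} (hθ : θ ∈ interior Θ) :
    IsMaxOn (fun θ' => ∑ i, w i * ℓ θ' (x i)) Θ θ
      ↔ (normalMatrix T X ψ w x).mulVec θ = normalVector P 𝓕 T b X ψ w x := by
  simp only [hℓ, quadForm_eq_quadFun, sum_mul_quadFun, ← normalMatrix_eq, ← normalVector_eq]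
  refine isMaxOn_quadFun_iff (by positivity) ?_ (fun v => ?_) hθ
  · simp only [normalMatrix_eq, Matrix.transpose_sum, Matrix.transpose_smul, gramMatrix_transpose]
  · rw [normalMatrix_eq, Matrix.sum_mulVec, dotProduct_sum]
    refine Finset.sum_nonneg fun i _ => ?_
    rw [Matrix.smul_mulVec, dotProduct_smul, smul_eq_mul]
    exact mul_nonneg (hw i) (dotProduct_gramMatrix_nonneg hT (h i) v)

lemma normWeight_nonneg [IsProbabilityMeasure P] {N : ℕ} (g : E d →ᵇ ℝ) (hε : 0 < ε)
    (hX : Measurable (X T)) (θk : Fin m → ℝ) (x : Fin N → Ω) (i : Fin N) :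
    0 ≤ normWeight P 𝓕 T ε W X g ψ θk x i := by
  have h : ∀ ω, 0 ≤ weight P 𝓕 T ε W X g ψ θk ω := fun ω =>
    div_nonneg (optDensity_pos g hε hX ω).le (girsanovDensity_pos ω).le
  exact div_nonneg (h _) (Finset.sum_nonneg fun n _ => h _)

/-- A continuous version of the log-likelihood is almost surely the quadratic form. -/
lemma IsLogLikelihood.ae_eq {ℓ : (Fin m → ℝ) → Ω → ℝ} (hℓ : IsLogLikelihood P 𝓕 T ε W X ψ ℓ)
    (h : ∀ θ, ∀ᵐ ω ∂P, Real.log (girsanovDensity P 𝓕 T ε W (linControl X ψ θ) ω)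
      = quadForm P 𝓕 T ε b X ψ θ ω) :
    ∀ᵐ ω ∂P, ∀ θ, ℓ θ ω = quadForm P 𝓕 T ε b X ψ θ ω := by
  -- Countably many null sets can be discarded together; on the remaining event both sides are
  -- continuous and agree on a dense set.
  obtain ⟨s, hs, hd⟩ := TopologicalSpace.exists_countable_dense (Fin m → ℝ)
  have h1 : ∀ᵐ ω ∂P, ∀ θ ∈ s, ℓ θ ω = quadForm P 𝓕 T ε b X ψ θ ω :=
    (ae_ball_iff hs).2 fun θ _ => by
      filter_upwards [hℓ.1 θ, h θ] with ω h1 h2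
      rw [h1, h2]
  filter_upwards [h1, hℓ.2] with ω h2 h3 θ
  have hc : Continuous fun θ => quadForm P 𝓕 T ε b X ψ θ ω := by
    simp only [quadForm_eq_quadFun]
    exact continuous_quadFun _ _ _
  exact congrFun (Continuous.ext_on hd h3 hc h2) θ

section Unit

variable [IsProbabilityMeasure P] (hW : IsBrownianMotion P 𝓕 T W) (hT : 0 < T)
  (hb : Measurable (fun p : E d × ℝ => b p.1 p.2))
  (hgrowth : ∃ C : ℝ, ∀ x, ∀ t ∈ Icc 0 T, ‖b x t‖ + frob (σ x t) ≤ C * (1 + ‖x‖))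
  (hX : IsStrongSolution P 𝓕 T ε W b σ x₀ X) (hσ : ∀ x, ∀ t ∈ Icc 0 T, σ x t = 1)

include hW hT hb hgrowth hX hσ

/-- The Girsanov density through the stochastic integral against the solution. -/
lemma log_girsanovDensity_eq {u : ℝ → Ω → E d} (hu : u ∈ controls d P 𝓕 T) :
    ∀ᵐ ω ∂P, Real.log (girsanovDensity P 𝓕 T ε W u ω)
      = -(1 / ε) * stochIntegral P 𝓕 T X u ω
        + 1 / ε * (∫ t in (0 : ℝ)..T, inner ℝ (u t ω) (b (X t ω) t))
        - 1 / (2 * ε) * ∫ t in (0 : ℝ)..T, ‖u t ω‖ ^ 2 := by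
  filter_upwards [stochIntegral_solution hW hT hb hgrowth hX hσ hu] with ω h
  -- In this form the constant meets `√ε` times the Itô integral, which is the integral against `X`
  -- minus the drift integral.
  have h1 : 1 / √ε = 1 / ε * √ε := by
    rw [one_div_mul_eq_div, Real.sqrt_div_self', one_div]
  rw [girsanovDensity, Real.log_exp, h, h1]
  ring

lemma log_girsanovDensity_linControl
    (hψ : ∀ j, (fun t ω => ψ j (X t ω) t) ∈ controls d P 𝓕 T) (θ : Fin m → ℝ) :
    ∀ᵐ ω ∂P, Real.log (girsanovDensity P 𝓕 T ε W (linControl X ψ θ) ω)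
      = quadForm P 𝓕 T ε b X ψ θ ω := by
  have h1 : ∀ᵐ ω ∂P, ∀ j, stochIntegral P 𝓕 T X (fun t ω => ψ j (X t ω) t) ω
      = (∫ t in (0 : ℝ)..T, inner ℝ (ψ j (X t ω) t) (b (X t ω) t))
        + √ε * stochIntegral P 𝓕 T W (fun t ω => ψ j (X t ω) t) ω :=
    ae_all_iff.2 fun j => stochIntegral_solution hW hT hb hgrowth hX hσ (hψ j)
  have h2 : ∀ᵐ ω ∂P, ∀ j, MemLp (fun t => ψ j (X t ω) t) 2 (volume.restrict (Icc 0 T)) :=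
    ae_all_iff.2 fun j => ae_memLp_path hT.le (hψ j)
  have h3 := hW.stochIntegral_sum hT hψ θ (linearCombination_mem_controls hT.le hψ θ)
  filter_upwards [h1, h2, h3] with ω h1 h2 h3
  have h4 : 1 / √ε = 1 / ε * √ε := by
    rw [one_div_mul_eq_div, Real.sqrt_div_self', one_div]
  have h5 : stochIntegral P 𝓕 T W (linControl X ψ θ) ω
      = ∑ j, θ j * stochIntegral P 𝓕 T W (fun t ω => ψ j (X t ω) t) ω := h3
  rw [girsanovDensity, Real.log_exp, energy_linControl hT.le h2, quadForm, h4, h5]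
  congr 1
  simp only [pathIntegral, driftIntegral, h1, add_sub_cancel_left, Finset.mul_sum]
  exact Finset.sum_congr rfl fun j _ => by ring

end Unit

end LinearControls

end CrossEntropy

/-! ### The main theorem -/

theorem mainTheorem4 {Ω : Type*} {mΩ : MeasurableSpace Ω} (P : Measure Ω) [IsProbabilityMeasure P]
    (𝓕 : Filtration ℝ mΩ) (d : ℕ) (T ε : ℝ) (hT : 0 < T) (hε : 0 < ε)
    (W : ℝ → Ω → E d) (hW : IsBrownianMotion P 𝓕 T W)
    (b : E d → ℝ → E d)
    (σ : E d → ℝ → Matrix (Fin d) (Fin d) ℝ)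
    (hb : Measurable (fun p : E d × ℝ => b p.1 p.2))
    (hσ : ∀ i j, Measurable (fun p : E d × ℝ => σ p.1 p.2 i j))
    (hgrowth : ∃ C : ℝ, ∀ x, ∀ t ∈ Icc 0 T,
      ‖b x t‖ + frob (σ x t) ≤ C * (1 + ‖x‖))
    (hlip : ∃ D : ℝ, ∀ x y, ∀ t ∈ Icc 0 T,
      ‖b x t - b y t‖ + frob (σ x t - σ y t) ≤ D * ‖x - y‖)
    (x₀ : E d) (X : ℝ → Ω → E d)
    (hX : IsStrongSolution P 𝓕 T ε W b σ x₀ X)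
    (g : E d →ᵇ ℝ) :
    -- the identity for the Kullback-Leibler divergence; everything in it is well defined
    (IsProbabilityMeasure (optMeasure P T ε X g) ∧
      Integrable (fun ω => optDensity P T ε X g ω
        * Real.log (optDensity P T ε X g ω)) P ∧
      ∀ u ∈ controls d P 𝓕 T,
        Integrable (fun ω => optDensity P T ε X g ω
          * Real.log (girsanovDensity P 𝓕 T ε W u ω)) P ∧
        optMeasure P T ε X g ≪ controlMeasure P 𝓕 T ε W u ∧
        Integrable (llr (optMeasure P T ε X g)
          (controlMeasure P 𝓕 T ε W u)) (optMeasure P T ε X g) ∧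
        klIntegral (optMeasure P T ε X g)
            (controlMeasure P 𝓕 T ε W u)
          = (∫ ω, optDensity P T ε X g ω
              * Real.log (optDensity P T ε X g ω) ∂P)
            - ceObjective P 𝓕 T ε W X g u ∧
        (IsProbabilityMeasure (controlMeasure P 𝓕 T ε W u) →
          klDiv (optMeasure P T ε X g) (controlMeasure P 𝓕 T ε W u)
            = ENNReal.ofReal (klIntegral (optMeasure P T ε X g)
                (controlMeasure P 𝓕 T ε W u)))) ∧
    -- minimizing the divergence is maximizing the objective, over all controls or a subclass
    (∀ 𝒱 ⊆ controls d P 𝓕 T, ∀ u ∈ 𝒱,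
      (IsMinOn (fun v => klIntegral (optMeasure P T ε X g)
          (controlMeasure P 𝓕 T ε W v)) 𝒱 u
        ↔ IsMaxOn (ceObjective P 𝓕 T ε W X g) 𝒱 u) ∧
      ((∀ v ∈ 𝒱, IsProbabilityMeasure (controlMeasure P 𝓕 T ε W v)) →
        (IsMinOn (fun v => klDiv (optMeasure P T ε X g)
            (controlMeasure P 𝓕 T ε W v)) 𝒱 u
          ↔ IsMaxOn (ceObjective P 𝓕 T ε W X g) 𝒱 u))) ∧
    -- a linear value function ansatz gives a control that is linear in the parameter
    (∀ (m : ℕ) (φ : Fin m → E d → ℝ → ℝ),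
      (∀ j t, Differentiable ℝ (fun x => φ j x t)) → ∀ (θ : Fin m → ℝ) x t,
        -(Matrix.toEuclideanLin (σ x t).transpose (gradient (fun y => ∑ j, θ j * φ j y t) x))
          = ∑ j, θ j • -(Matrix.toEuclideanLin (σ x t).transpose
              (gradient (fun y => φ j y t) x))) ∧
    -- from here on `σ = 1`
    ((∀ x, ∀ t ∈ Icc 0 T, σ x t = 1) →
      -- the Girsanov density through `dX`
      (∀ u ∈ controls d P 𝓕 T, ∀ᵐ ω ∂P,
        Real.log (girsanovDensity P 𝓕 T ε W u ω)
          = -(1 / ε) * stochIntegral P 𝓕 T X u ω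
            + 1 / ε * (∫ t in (0 : ℝ)..T, inner ℝ (u t ω) (b (X t ω) t))
            - 1 / (2 * ε) * ∫ t in (0 : ℝ)..T, ‖u t ω‖ ^ 2) ∧
      ∀ (m : ℕ) (ψ : Fin m → E d → ℝ → E d),
        (∀ j, Measurable (fun p : E d × ℝ => ψ j p.1 p.2)) →
        (∀ j, SqIntegrable P T (fun t ω => ψ j (X t ω) t)) →
        (∀ θ, linControl X ψ θ ∈ controls d P 𝓕 T) ∧
        -- change of the sampling measure to the current proposal
        (∀ θk θ,
          Integrable (fun ω => weight P 𝓕 T ε W X g ψ θk ω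
              * Real.log (girsanovDensity P 𝓕 T ε W
                  (linControl X ψ θ) ω))
            (controlMeasure P 𝓕 T ε W (linControl X ψ θk)) ∧
          ∫ ω, weight P 𝓕 T ε W X g ψ θk ω
              * Real.log (girsanovDensity P 𝓕 T ε W
                  (linControl X ψ θ) ω)
              ∂(controlMeasure P 𝓕 T ε W (linControl X ψ θk))
            = ceObjective P 𝓕 T ε W X g (linControl X ψ θ)) ∧
        (∀ (Θ : Set (Fin m → ℝ)) (θk : Fin m → ℝ), ∀ θ ∈ Θ,
          (IsMinOn (fun η => klIntegral (optMeasure P T ε X g)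
              (controlMeasure P 𝓕 T ε W (linControl X ψ η))) Θ θ
            ↔ IsMaxOn (fun η => ∫ ω, weight P 𝓕 T ε W X g ψ θk ω
                * Real.log (girsanovDensity P 𝓕 T ε W
                    (linControl X ψ η) ω)
                ∂(controlMeasure P 𝓕 T ε W (linControl X ψ θk)))
              Θ θ)) ∧
        -- `log L^θ_T` is a concave quadratic function of `θ`
        (∀ θ, ∀ᵐ ω ∂P,
          Real.log (girsanovDensity P 𝓕 T ε W (linControl X ψ θ) ω)
            = quadForm P 𝓕 T ε b X ψ θ ω) ∧
        (∃ ℓ, IsLogLikelihood P 𝓕 T ε W X ψ ℓ) ∧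
        ∀ ℓ, IsLogLikelihood P 𝓕 T ε W X ψ ℓ →
          (∀ᵐ ω ∂P, (∀ θ, ℓ θ ω = quadForm P 𝓕 T ε b X ψ θ ω) ∧
            ConcaveOn ℝ univ (fun θ => ℓ θ ω)) ∧
          -- the weighted maximum likelihood update solves the weighted normal equations
          ∀ (Ω' : Type*) [MeasurableSpace Ω'] (P' : Measure Ω') [IsProbabilityMeasure P']
            (N : ℕ) (θk : Fin m → ℝ) (ξ : Fin N → Ω' → Ω),
            iIndepFun ξ P' →
            (∀ i, HasLaw (ξ i)
              (controlMeasure P 𝓕 T ε W (linControl X ψ θk)) P') →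
            ∀ᵐ η ∂P', ∀ (w : Fin N → ℝ),
              w = normWeight P 𝓕 T ε W X g ψ θk (fun i => ξ i η) → ∀ θ : Fin m → ℝ,
                (IsMaxOn (fun θ' => ∑ i, w i * ℓ θ' (ξ i η)) univ θ
                  ↔ (normalMatrix T X ψ w (fun i => ξ i η)).mulVec θ
                    = normalVector P 𝓕 T b X ψ w (fun i => ξ i η)) ∧
                ∀ Θ : Set (Fin m → ℝ), θ ∈ interior Θ →
                  (IsMaxOn (fun θ' => ∑ i, w i * ℓ θ' (ξ i η)) Θ θ
                    ↔ (normalMatrix T X ψ w (fun i => ξ i η)).mulVec θ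
                      = normalVector P 𝓕 T b X ψ w (fun i => ξ i η)))
    := by
  have hXT : Measurable (X T) := ((hX.adapted T ⟨hT.le, le_rfl⟩).mono (𝓕.le T)).measurable
  have hprob := isProbabilityMeasure_optMeasure (P := P) g hε hXT
  have hKL := fun u (hu : u ∈ controls d P 𝓕 T) => klIntegral_controlMeasure g hW hT hε hXT hu
  have hdiv := fun u (hu : u ∈ controls d P 𝓕 T)
      (_ : IsProbabilityMeasure (controlMeasure P 𝓕 T ε W u)) =>
    klDiv_eq_ofReal_klIntegral (hKL u hu).2.1 (hKL u hu).2.2.1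
  refine ⟨⟨hprob, integrable_optDensity_mul g hε hXT (integrable_log_optDensity g hε hXT),
    fun u hu => ⟨(hKL u hu).1, (hKL u hu).2.1, (hKL u hu).2.2.1, (hKL u hu).2.2.2,
      fun h => (hdiv u hu h).2⟩⟩, ?_, ?_, ?_⟩
  · intro 𝒱 h𝒱 u hu
    have hiff := isMinOn_iff_isMaxOn_of_eq_sub hu fun v hv => (hKL v (h𝒱 hv)).2.2.2
    refine ⟨hiff, fun hV => Iff.trans ?_ hiff⟩
    simp only [isMinOn_iff]
    refine forall₂_congr fun v hv => ?_
    -- The real divergences are nonnegative, so comparing them in `ℝ≥0∞` is the same as comparing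
    -- them in `ℝ`.
    rw [(hdiv u (h𝒱 hu) (hV u hu)).2, (hdiv v (h𝒱 hv) (hV v hv)).2,
      ENNReal.ofReal_le_ofReal_iff (hdiv v (h𝒱 hv) (hV v hv)).1]
  · intro m φ hφ θ x t
    rw [gradient_sum_mul _ (fun j _ => hφ j t x), map_sum, ← Finset.sum_neg_distrib]
    exact Finset.sum_congr rfl fun j _ => by rw [map_smul, smul_neg]
  · intro hσ1
    refine ⟨fun u hu => log_girsanovDensity_eq hW hT hb hgrowth hX hσ1 hu, ?_⟩
    intro m ψ hψm hψi
    have hψ : ∀ j, (fun t ω => ψ j (X t ω) t) ∈ controls d P 𝓕 T := fun j =>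
      ⟨hX.progressiveOn_comp (hψm j), hψi j⟩
    have hlin : ∀ θ, linControl X ψ θ ∈ controls d P 𝓕 T := fun θ =>
      linearCombination_mem_controls hT.le hψ θ
    have hweight := fun θk θ => integral_weight_mul (ε := ε) (W := W) g hT (hlin θk)
      (hKL _ (hlin θ)).1
    have hquad := fun θ => log_girsanovDensity_linControl hW hT hb hgrowth hX hσ1 hψ θ
    have hpath : ∀ᵐ ω ∂P, ∀ j, MemLp (fun t => ψ j (X t ω) t) 2 (volume.restrict (Icc 0 T)) :=
      ae_all_iff.2 fun j => ae_memLp_path hT.le (hψ j)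
    refine ⟨hlin, hweight, fun Θ θk θ hθ => ?_, hquad, ?_, fun ℓ hℓ => ?_⟩
    · refine isMinOn_iff_isMaxOn_of_eq_sub hθ (c := ∫ ω, optDensity P T ε X g ω
        * Real.log (optDensity P T ε X g ω) ∂P) fun η _ => ?_
      rw [(hKL _ (hlin η)).2.2.2, (hweight θk η).2]
      rfl
    · refine ⟨fun θ ω => quadForm P 𝓕 T ε b X ψ θ ω, fun θ => ?_, ae_of_all _ fun ω => ?_⟩
      · filter_upwards [hquad θ] with ω hω using hω.symm
      · simp only [quadForm_eq_quadFun]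
        exact continuous_quadFun _ _ _
    · have hae := hℓ.ae_eq hquad
      refine ⟨?_, ?_⟩
      · filter_upwards [hae, hpath] with ω h1 h2
        refine ⟨h1, ?_⟩
        simp only [h1, quadForm_eq_quadFun]
        exact concaveOn_quadFun (by positivity) (dotProduct_gramMatrix_nonneg hT.le h2) _
      · intro Ω' _ P' _ N θk ξ _ hlaw
        -- Each sample has a law absolutely continuous with respect to `P`, so almost surely all of
        -- the finitely many samples avoid the exceptional `P`-null set, simultaneously for all `θ`.
        have hsample : ∀ᵐ η ∂P', ∀ i, (∀ θ, ℓ θ (ξ i η) = quadForm P 𝓕 T ε b X ψ θ (ξ i η)) ∧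
            ∀ j, MemLp (fun t => ψ j (X t (ξ i η)) t) 2 (volume.restrict (Icc 0 T)) := by
          refine ae_all_iff.2 fun i => ae_of_ae_map (hlaw i).aemeasurable
            (p := fun ω => (∀ θ, ℓ θ ω = quadForm P 𝓕 T ε b X ψ θ ω) ∧
              ∀ j, MemLp (fun t => ψ j (X t ω) t) 2 (volume.restrict (Icc 0 T))) ?_
          rw [(hlaw i).map_eq]
          exact (withDensity_absolutelyContinuous P _).ae_le (hae.and hpath)
        filter_upwards [hsample] with η hη w hw θ
        have hw0 : ∀ i, 0 ≤ w i := hw ▸ normWeight_nonneg g hε hXT θk _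
        have hmain := fun Θ (hθ : θ ∈ interior Θ) => isMaxOn_weighted_iff (Θ := Θ) hT.le hε hw0
          (fun i => (hη i).1) (fun i => (hη i).2) hθ
        exact ⟨hmain univ (by simp), hmain⟩
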